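/- Let $M \in \mathbb{R}$. There is a constant $C > 0$, depending only on $M$, such that the following holds for every $n \geq 1$ and every bounded continuous function $V : \mathbb{R}^n \to \mathbb{R}$ with $0 < V(x) \leq M$ for all $x \in \mathbb{R}^n$. Let $(u_0, u_1) \in H^1(\mathbb{R}^n) \times L^2(\mathbb{R}^n)$ be real-valued initial data such that $$K_0^2 := \int_{\mathbb{R}^n} \frac{|u_1(x) + u_0(x)|^2}{V(x)}\, dx < \infty.$$ Then the Cauchy problem $$u_{tt} - \Delta u + V(x) u + u_t = 0 \quad (t > 0,\ x \in \mathbb{R}^n), \qquad u(0,x) = u_0(x), \quad u_t(0,x) = u_1(x),$$ has a unique weak solution $u \in C([0,\infty); H^1(\mathbb{R}^n)) \cap C^1([0,\infty); L^2(\mathbb{R}^n))$, where weak solution means that for every $\varphi \in H^1(\mathbb{R}^n)$ and every $t > 0$ $$\frac{d}{dt}(u_t(t,\cdot), \varphi) + (\nabla u(t,\cdot), \nabla\varphi) + (V u(t,\cdot), \varphi) + (u_t(t,\cdot), \varphi) = 0$$ with $(\cdot,\cdot)$ the $L^2(\mathbb{R}^n)$ inner product. With the energy $$E(t) := \frac12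 \int_{\mathbb{R}^n} \left( |u_t(t,x)|^2 + |\nabla u(t,x)|^2 + V(x) |u(t,x)|^2 \right) dx$$ and $\|\cdot\|$ the norm of $L^2(\mathbb{R}^n)$, this solution satisfies, for all $t \geq 0$, $$(1+t)^2 E(t) \leq C \left( \|u_0\|^2 + \|u_1\|^2 + \|\nabla u_0\|^2 + K_0^2 \right),$$ $$(1+t) \|u(t,\cdot)\|^2 \leq C \left( \|u_0\|^2 + \|u_1\|^2 + \|\nabla u_0\|^2 + K_0^2 \right).$$ -/

import Mathlib

open MeasureTheory Set
open scoped ContDiff BoundedContinuousFunction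

noncomputable section

namespace DampedWave

/-- The Euclidean space `ℝⁿ`. -/
abbrev Space (n : ℕ) : Type := EuclideanSpace ℝ (Fin n)

/-- The real-valued Lebesgue space `L²(ℝⁿ)`. -/
abbrev L2 (n : ℕ) : Type := Lp ℝ 2 (volume : Measure (Space n))

/-- The space `L²(ℝⁿ; ℝⁿ)` of square integrable vector fields. -/
abbrev L2Vec (n : ℕ) : Type := Lp (Space n) 2 (volume : Measure (Space n))

/-- `G` is the weak gradient of `f`: integration by parts holds against every `φ ∈ C₀^∞(ℝⁿ)`.
The function `f ∈ L²(ℝⁿ)` belongs to `H¹(ℝⁿ)` if and only if such a `G ∈ L²(ℝⁿ; ℝⁿ)` exists. -/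
def HasWeakGradient {n : ℕ} (f : L2 n) (G : L2Vec n) : Prop :=
  ∀ φ : Space n → ℝ, ContDiff ℝ ∞ φ → HasCompactSupport φ → ∀ i : Fin n,
    ∫ x, f x * fderiv ℝ φ x (EuclideanSpace.single i 1) = -∫ x, G x i * φ x

/-- `u` is a weak solution, in the class `C([0,∞); H¹(ℝⁿ)) ∩ C¹([0,∞); L²(ℝⁿ))`, of
`u_tt - Δu + V u + u_t = 0` on `(0,∞) × ℝⁿ` with `u(0) = u₀` and `u_t(0) = u₁`.
The curves `ut` and `Du` are the time derivative and the spatial gradient of `u`; only the values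
at times `t ≥ 0` matter. The continuity of `u` and `Du` in `L²` is the continuity of `u` in `H¹`.
The equation is tested against every `φ ∈ H¹(ℝⁿ)` (with weak gradient `Φ`):
`d/dt (u_t, φ) + (∇u, ∇φ) + (V u, φ) + (u_t, φ) = 0` for `t > 0`. -/
structure IsWeakSolution {n : ℕ} (V : Space n →ᵇ ℝ) (u₀ u₁ : L2 n)
    (u ut : ℝ → L2 n) (Du : ℝ → L2Vec n) : Prop where
  hasWeakGradient : ∀ t, 0 ≤ t → HasWeakGradient (u t) (Du t)
  continuousOn : ContinuousOn u (Ici 0)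
  continuousOn_gradient : ContinuousOn Du (Ici 0)
  hasDerivWithinAt : ∀ t, 0 ≤ t → HasDerivWithinAt u (ut t) (Ici 0) t
  continuousOn_deriv : ContinuousOn ut (Ici 0)
  initial : u 0 = u₀
  initial_deriv : ut 0 = u₁
  equation : ∀ (φ : L2 n) (Φ : L2Vec n), HasWeakGradient φ Φ → ∀ t, 0 < t →
    HasDerivAt (fun s => ∫ x, ut s x * φ x)
      (-((∫ x, inner ℝ (Du t x) (Φ x)) + (∫ x, V x * u t x * φ x) + ∫ x, ut t x * φ x)) t

/-- The total energy `½ ∫ (|u_t|² + |∇u|² + V |u|²) dx` of a state with displacement `f`,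
velocity `g` and displacement gradient `G`. -/
def energy {n : ℕ} (V : Space n →ᵇ ℝ) (f g : L2 n) (G : L2Vec n) : ℝ :=
  (1 / 2) * ∫ x, (|g x| ^ 2 + ‖G x‖ ^ 2 + V x * |f x| ^ 2)

end DampedWave

end

/-!
With `D f = (∇f, √V f)` the equation reads `u'' + D†D u + u' = 0`, a problem about an arbitrary
closed densely defined operator `D` between Hilbert spaces. Since `D† D + 1` is onto, the generator
`(v, F) ↦ (-D†F - v, D v)` of the first order system for `v = u'`, `F = D u` is m-dissipative, and
its Yosida approximations converge to a mild solution, which satisfies the weak equation.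
Uniqueness and the energy identity come from testing the equation with the solution itself; this is
legitimate after the resolvent has regularised it.

For the decay, integrate the equation in time: `u' + u + D†∫₀ᵗ D u = u'(0) + u(0)`. Tested with `u`,
this controls `∫₀ᵗ ‖u‖²` as soon as `u'(0) + u(0)` is bounded in the norm dual to `‖D ·‖`, and the
weight `1 / V` provides such a bound by the constant `K₀`. With `∫ ‖u‖²` under control, the
multipliers `u'` and `u`, weighted by powers of `1 + t`, give a Lyapunov functional that dominates
both `(1 + t)² E` and `(1 + t) ‖u‖²`.
-/

noncomputable section

namespace DampedWave

open Filter Topology NormedSpace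

section Calculus

variable {E : Type*} [NormedAddCommGroup E] [NormedSpace ℝ E] [CompleteSpace E]

theorem hasDerivWithinAt_integral_Ici {f : ℝ → E} {a t : ℝ} (hf : ContinuousOn f (Ici a))
    (ht : a ≤ t) : HasDerivWithinAt (fun s => ∫ r in a..s, f r) (f t) (Ici a) t := by
  have hint : IntervalIntegrable f volume a t :=
    (hf.mono (uIcc_of_le ht ▸ Icc_subset_Ici_self)).intervalIntegrable
  rcases ht.eq_or_lt with rfl | ht
  · exact intervalIntegral.integral_hasDerivWithinAt_right hint
      (hf.mono Ioi_subset_Ici_self |>.stronglyMeasurableAtFilter_nhdsWithin measurableSet_Ioi a)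
      ((hf a self_mem_Ici).mono Ioi_subset_Ici_self)
  · exact (intervalIntegral.integral_hasDerivAt_right hint
      (hf.mono Ioi_subset_Ici_self |>.stronglyMeasurableAtFilter isOpen_Ioi t ht)
      (hf.continuousAt (Ici_mem_nhds ht))).hasDerivWithinAt

theorem hasDerivAt_integral_of_continuousOn_Ici {f : ℝ → E} {a t : ℝ}
    (hf : ContinuousOn f (Ici a)) (ht : a < t) : HasDerivAt (fun s => ∫ r in a..s, f r) (f t) t :=
  (hasDerivWithinAt_integral_Ici hf ht.le).hasDerivAt (Ici_mem_nhds ht)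

theorem continuousOn_integral_Ici {f : ℝ → E} {a : ℝ} (hf : ContinuousOn f (Ici a)) :
    ContinuousOn (fun s => ∫ r in a..s, f r) (Ici a) := fun _ ht =>
  (hasDerivWithinAt_integral_Ici hf ht).continuousWithinAt

theorem intervalIntegral_mem {S : Submodule ℝ E} (hS : IsClosed (S : Set E)) {f : ℝ → E}
    {a b : ℝ} (hf : IntervalIntegrable f volume a b) (hfS : ∀ t ∈ uIcc a b, f t ∈ S) :
    ∫ t in a..b, f t ∈ S := by
  rw [← S.ker_mkQ, LinearMap.mem_ker, ← S.mkQL_apply, ← S.mkQL.intervalIntegral_comp_comm hf,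
    intervalIntegral.integral_congr (g := fun _ => 0), intervalIntegral.integral_zero]
  exact fun t ht => (Submodule.Quotient.mk_eq_zero S).2 (hfS t ht)

theorem antitoneOn_Ici_of_hasDerivAt_nonpos {f f' : ℝ → ℝ} {a : ℝ} (hf : ContinuousOn f (Ici a))
    (hd : ∀ t, a < t → HasDerivAt f (f' t) t) (hf' : ∀ t, a < t → f' t ≤ 0) :
    AntitoneOn f (Ici a) :=
  antitoneOn_of_hasDerivWithinAt_nonpos (convex_Ici a) hf
    (fun t ht => (hd t (interior_Ici.subset ht)).hasDerivWithinAt)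
    (fun t ht => hf' t (interior_Ici.subset ht))

theorem isClosed_setOf_uniformCauchySeqOn {ι T X Y : Type*} [PseudoMetricSpace X]
    [PseudoMetricSpace Y] {U : ι → T → X → Y} {l : Filter ι} {s : Set T}
    (hU : ∀ n, ∀ t ∈ s, LipschitzWith 1 (U n t)) :
    IsClosed {x | UniformCauchySeqOn (fun n t => U n t x) l s} := by
  refine isClosed_of_closure_subset fun x hx u hu => ?_
  obtain ⟨ε, hε, hεu⟩ := Metric.mem_uniformity_dist.1 hu
  obtain ⟨y, hy, hxy⟩ := Metric.mem_closure_iff.1 hx (ε / 3) (by positivity)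
  filter_upwards [hy _ (Metric.dist_mem_uniformity (show 0 < ε / 3 by positivity))]
    with ⟨m, n⟩ hmn t ht
  refine hεu ?_
  have hm : dist (U m t x) (U m t y) ≤ dist x y := by simpa using (hU m t ht).dist_le_mul x y
  have hn : dist (U n t y) (U n t x) ≤ dist x y := by
    simpa [dist_comm x y] using (hU n t ht).dist_le_mul y x
  have hmn : dist (U m t y) (U n t y) < ε / 3 := hmn t ht
  linarith [dist_triangle4 (U m t x) (U m t y) (U n t y) (U n t x)]

end Calculus

section MDissipative

variable {X : Type*} [NormedAddCommGroup X] [InnerProductSpace ℝ X]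

/-- An unbounded operator `A` on a Hilbert space is m-dissipative if it is dissipative and `1 - lA`
is onto for every `l > 0`; such operators generate contraction semigroups. -/
structure IsMDissipative (A : X →ₗ.[ℝ] X) : Prop where
  inner_nonpos : ∀ x : A.domain, inner ℝ (A x) (x : X) ≤ 0
  surjective : ∀ l : ℝ, 0 < l → Function.Surjective fun x : A.domain => (x : X) - l • A x

namespace IsMDissipative

variable {A : X →ₗ.[ℝ] X} {l m : ℝ}

theorem norm_le_norm_sub_smul (hA : IsMDissipative A) (hl : 0 < l) (x : A.domain) :
    ‖(x : X)‖ ≤ ‖(x : X) - l • A x‖ := by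
  have hsq := norm_sub_sq_real (x : X) (l • A x)
  rw [inner_smul_right, real_inner_comm] at hsq
  refine le_of_sq_le_sq ?_ (norm_nonneg _)
  nlinarith [sq_nonneg ‖l • A x‖, mul_nonneg hl.le (neg_nonneg.2 (hA.inner_nonpos x))]

theorem bijective (hA : IsMDissipative A) (hl : 0 < l) :
    Function.Bijective (A.domain.subtype - l • A.toFun) := by
  refine ⟨(injective_iff_map_eq_zero _).2 fun x hx => ?_, hA.surjective l hl⟩
  have hx' : (x : X) - l • A x = 0 := hx
  have := hA.norm_le_norm_sub_smul hl x
  rw [hx', norm_zero] at this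
  exact Subtype.ext (norm_le_zero_iff.1 this)

/-- The resolvent `(1 - lA)⁻¹` of an m-dissipative operator, an everywhere defined contraction. -/
def resolvent (hA : IsMDissipative A) (hl : 0 < l) : X →L[ℝ] X :=
  (A.domain.subtype ∘ₗ
    (LinearEquiv.ofBijective _ (hA.bijective hl)).symm.toLinearMap).mkContinuous 1 fun z => by
    set e := LinearEquiv.ofBijective _ (hA.bijective hl)
    calc ‖(e.symm z : X)‖ ≤ ‖e (e.symm z)‖ := hA.norm_le_norm_sub_smul hl (e.symm z)
      _ = 1 * ‖z‖ := by rw [e.apply_symm_apply, one_mul]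

/-- The Yosida approximation `A (1 - lA)⁻¹` of an m-dissipative operator `A`. -/
def yosida (hA : IsMDissipative A) (hl : 0 < l) : X →L[ℝ] X :=
  l⁻¹ • (hA.resolvent hl - 1)

theorem resolvent_sub_smul (hA : IsMDissipative A) (hl : 0 < l) (x : A.domain) :
    hA.resolvent hl ((x : X) - l • A x) = x :=
  congrArg Subtype.val <|
    (LinearEquiv.ofBijective _ (hA.bijective hl)).symm_apply_apply x

theorem yosida_sub_smul (hA : IsMDissipative A) (hl : 0 < l) (x : A.domain) :
    hA.yosida hl ((x : X) - l • A x) = A x := by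
  simp [yosida, hA.resolvent_sub_smul hl, hl.ne']

theorem norm_resolvent_le (hA : IsMDissipative A) (hl : 0 < l) (z : X) :
    ‖hA.resolvent hl z‖ ≤ ‖z‖ := by
  obtain ⟨x, rfl⟩ := hA.surjective l hl z
  simpa only [hA.resolvent_sub_smul hl] using hA.norm_le_norm_sub_smul hl x

theorem resolvent_yosida_mem_graph (hA : IsMDissipative A) (hl : 0 < l) (z : X) :
    (hA.resolvent hl z, hA.yosida hl z) ∈ A.graph := by
  obtain ⟨x, rfl⟩ := hA.surjective l hl z
  simpa only [hA.resolvent_sub_smul hl, hA.yosida_sub_smul hl] using A.mem_graph x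

theorem resolvent_eq_add_smul_yosida (hA : IsMDissipative A) (hl : 0 < l) (z : X) :
    hA.resolvent hl z = z + l • hA.yosida hl z := by
  simp [yosida, hl.ne']

theorem resolvent_apply_eq_yosida (hA : IsMDissipative A) (hl : 0 < l) (x : A.domain) :
    hA.resolvent hl (A x) = hA.yosida hl x := by
  have h := hA.resolvent_sub_smul hl x
  rw [map_sub, map_smul, sub_eq_iff_eq_add'] at h
  simp [yosida, h, hl.ne']

theorem resolvent_eq_yosida_of_mem_graph (hA : IsMDissipative A) (hl : 0 < l) {x y : X}
    (h : (x, y) ∈ A.graph) : hA.resolvent hl y = hA.yosida hl x := by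
  obtain ⟨x, rfl, rfl⟩ := A.mem_graph_iff.1 h
  exact hA.resolvent_apply_eq_yosida hl x

theorem isClosed (hA : IsMDissipative A) : A.IsClosed := by
  have hgraph : (A.graph : Set (X × X)) = {p | hA.resolvent one_pos (p.1 - p.2) = p.1} := by
    ext ⟨x, y⟩
    constructor
    · intro h
      obtain ⟨x, rfl, rfl⟩ := A.mem_graph_iff.1 h
      simpa using hA.resolvent_sub_smul one_pos x
    · rintro (h : hA.resolvent one_pos (x - y) = x)
      simpa [yosida, h] using hA.resolvent_yosida_mem_graph one_pos (x - y)
  rw [LinearPMap.IsClosed, hgraph]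
  exact isClosed_eq (by fun_prop) continuous_fst

theorem yosida_commute (hA : IsMDissipative A) (hl : 0 < l) (hm : 0 < m) :
    Commute (hA.yosida hl) (hA.yosida hm) := by
  have hJ : Commute (hA.resolvent hl) (hA.resolvent hm) := by
    ext z
    obtain ⟨x, rfl⟩ := hA.surjective m hm z
    obtain ⟨w, hw, hAw⟩ := A.mem_graph_iff.1 (hA.resolvent_yosida_mem_graph hl (x : X))
    calc hA.resolvent hl (hA.resolvent hm ((x : X) - m • A x))
        = hA.resolvent hl x := by rw [hA.resolvent_sub_smul hm]
      _ = hA.resolvent hm (hA.resolvent hl x - m • hA.yosida hl x) := by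
        simpa only [hw, hAw] using (hA.resolvent_sub_smul hm w).symm
      _ = hA.resolvent hm (hA.resolvent hl ((x : X) - m • A x)) := by
        rw [map_sub (hA.resolvent hl), map_smul, hA.resolvent_apply_eq_yosida hl]
  exact (((hJ.sub_left (Commute.one_left _)).sub_right
    (Commute.one_right _)).smul_left _).smul_right _

theorem inner_nonpos_of_mem_graph (hA : IsMDissipative A) {x y : X} (h : (x, y) ∈ A.graph) :
    inner ℝ y x ≤ 0 := by
  obtain ⟨x, rfl, rfl⟩ := A.mem_graph_iff.1 h
  exact hA.inner_nonpos x

theorem inner_yosida_nonpos (hA : IsMDissipative A) (hl : 0 < l) (z : X) :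
    inner ℝ (hA.yosida hl z) z ≤ 0 := by
  have h := hA.inner_nonpos_of_mem_graph (hA.resolvent_yosida_mem_graph hl z)
  rw [hA.resolvent_eq_add_smul_yosida hl, inner_add_right, inner_smul_right] at h
  linarith [mul_nonneg hl.le (real_inner_self_nonneg (x := hA.yosida hl z))]

theorem dense_domain [CompleteSpace X] (hA : IsMDissipative A) : Dense (A.domain : Set X) := by
  rw [Submodule.dense_iff_topologicalClosure_eq_top, Submodule.topologicalClosure_eq_top_iff,
    Submodule.eq_bot_iff]
  intro z hz
  -- Test `z = x - A x` against `x`: both terms of `‖x‖² - ⟪A x, x⟫ = 0` are nonnegative.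
  obtain ⟨x, rfl⟩ := hA.surjective 1 one_pos z
  have horth : ‖(x : X)‖ ^ 2 - inner ℝ (A x) (x : X) = 0 := by
    simpa [inner_sub_left] using (Submodule.mem_orthogonal' _ _).1 hz x x.2
  have hx : x = 0 := Subtype.ext <| norm_eq_zero.1 <| pow_eq_zero_iff two_ne_zero |>.1 <|
    le_antisymm (by linarith [hA.inner_nonpos x]) (sq_nonneg _)
  simp [hx]

section Convergence

variable [CompleteSpace X] {ι : Type*} {F : Filter ι} {l : ι → ℝ}

theorem tendsto_resolvent (hA : IsMDissipative A) (hl : ∀ i, 0 < l i) (hl₀ : Tendsto l F (𝓝 0))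
    (x : X) : Tendsto (fun i => hA.resolvent (hl i) x) F (𝓝 x) := by
  have hequi : Equicontinuous fun i => hA.resolvent (hl i) :=
    (LipschitzWith.uniformEquicontinuous _ 1 fun i =>
      AddMonoidHomClass.lipschitz_of_bound_nnnorm _ 1 fun z => by
        rw [one_mul]
        exact hA.norm_resolvent_le (hl i) z).equicontinuous
  refine hA.dense_domain.induction (P := fun x =>
    Tendsto (fun i => hA.resolvent (hl i) x) F (𝓝 x)) (fun x hx => ?_)
    (hequi.isClosed_setOfPred_tendsto continuous_id) x
  rw [tendsto_iff_norm_sub_tendsto_zero]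
  refine squeeze_zero (fun _ => norm_nonneg _) (fun i => ?_)
    (by simpa using hl₀.mul_const ‖A ⟨x, hx⟩‖)
  rw [hA.resolvent_eq_add_smul_yosida, add_sub_cancel_left, norm_smul,
    Real.norm_of_nonneg (hl i).le, ← hA.resolvent_apply_eq_yosida (hl i) ⟨x, hx⟩]
  exact mul_le_mul_of_nonneg_left (hA.norm_resolvent_le _ _) (hl i).le

theorem tendsto_resolvent_of_tendsto (hA : IsMDissipative A) (hl : ∀ i, 0 < l i)
    (hl₀ : Tendsto l F (𝓝 0)) {z : ι → X} {x : X} (hz : Tendsto z F (𝓝 x)) :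
    Tendsto (fun i => hA.resolvent (hl i) (z i)) F (𝓝 x) := by
  have hsub : Tendsto (fun i => hA.resolvent (hl i) (z i - x)) F (𝓝 0) :=
    squeeze_zero_norm (fun i => hA.norm_resolvent_le _ _) (tendsto_iff_norm_sub_tendsto_zero.1 hz)
  simpa using hsub.add (hA.tendsto_resolvent hl hl₀ x)

end Convergence

end IsMDissipative

theorem hasDerivAt_exp_smul_apply [CompleteSpace X] (B : X →L[ℝ] X) (x : X) (t : ℝ) :
    HasDerivAt (fun s : ℝ => exp (s • B) x) (B (exp (t • B) x)) t :=
  (hasDerivAt_exp_smul_const' B t).clm_apply (hasDerivAt_const t x) |>.congr_deriv (by simp)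

theorem continuous_exp_smul_apply [CompleteSpace X] (B : X →L[ℝ] X) (x : X) :
    Continuous fun t : ℝ => exp (t • B) x :=
  continuous_iff_continuousAt.2 fun t => (hasDerivAt_exp_smul_apply B x t).continuousAt

theorem norm_exp_smul_apply_le [CompleteSpace X] {B : X →L[ℝ] X}
    (hB : ∀ z, inner ℝ (B z) z ≤ 0) {t : ℝ} (ht : 0 ≤ t) (x : X) : ‖exp (t • B) x‖ ≤ ‖x‖ := by
  have hanti := antitoneOn_Ici_of_hasDerivAt_nonpos (a := 0)
    ((continuous_exp_smul_apply B x).norm.pow 2).continuousOn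
    (fun s _ => (hasDerivAt_exp_smul_apply B x s).norm_sq)
    (fun s _ => by rw [real_inner_comm]; linarith [hB (exp (s • B) x)])
  refine le_of_sq_le_sq ?_ (norm_nonneg _)
  simpa using hanti self_mem_Ici ht ht

theorem norm_exp_smul_sub_le [CompleteSpace X] {B C : X →L[ℝ] X} (hBC : Commute B C)
    (hB : ∀ z, inner ℝ (B z) z ≤ 0) (hC : ∀ z, inner ℝ (C z) z ≤ 0) {t : ℝ} (ht : 0 ≤ t) (x : X) :
    ‖exp (t • B) x - exp (t • C) x‖ ≤ ‖B x - C x‖ * t := by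
  -- Interpolate between the two curves by `s ↦ exp ((t - s) C) exp (s B) x`.
  have hd : ∀ s : ℝ, HasDerivAt (fun s : ℝ => exp ((t - s) • C) (exp (s • B) x))
      (exp ((t - s) • C) (exp (s • B) (B x - C x))) s := by
    intro s
    have hexp : HasDerivAt (fun s : ℝ => exp ((t - s) • C)) (-(exp ((t - s) • C) * C)) s := by
      refine ((hasDerivAt_exp_smul_const C (t - s)).scomp s
        ((hasDerivAt_id s).const_sub t)).congr_deriv (neg_one_smul ℝ _)
    refine (hexp.clm_apply (hasDerivAt_exp_smul_apply B x s)).congr_deriv ?_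
    have hBexp : B (exp (s • B) x) = exp (s • B) (B x) :=
      DFunLike.congr_fun (((Commute.refl B).smul_right s).exp_right).eq x
    have hCexp : C (exp (s • B) x) = exp (s • B) (C x) :=
      DFunLike.congr_fun ((hBC.symm.smul_right s).exp_right).eq x
    simp [hBexp, hCexp, sub_eq_neg_add]
  have hlip := norm_image_sub_le_of_norm_deriv_le_segment' (a := 0) (b := t) (C := ‖B x - C x‖)
    (fun s _ => (hd s).hasDerivWithinAt) (fun s hs =>
      (norm_exp_smul_apply_le hC (sub_nonneg.2 hs.2.le) _).trans (norm_exp_smul_apply_le hB hs.1 _))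
    t (right_mem_Icc.2 ht)
  simpa using hlip

/-- Mild solutions on `[0, ∞)` of `x' = A x`: the equation integrated in time, which makes sense
for curves that do not take values in the domain of `A`. -/
structure IsMildSolution (A : X →ₗ.[ℝ] X) (x : ℝ → X) : Prop where
  continuousOn : ContinuousOn x (Ici 0)
  integral_mem_graph : ∀ t, 0 ≤ t → (∫ s in 0..t, x s, x t - x 0) ∈ A.graph

namespace IsMDissipative

variable {A : X →ₗ.[ℝ] X} [CompleteSpace X]

section YosidaLimit

variable {l : ℕ → ℝ}

theorem uniformCauchySeqOn_exp_yosida (hA : IsMDissipative A) (hl : ∀ n, 0 < l n)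
    (hl₀ : Tendsto l atTop (𝓝 0)) (T : ℝ) (x : X) :
    UniformCauchySeqOn (fun n t => exp (t • hA.yosida (hl n)) x) atTop (Icc 0 T) := by
  have hlip : ∀ n, ∀ t ∈ Icc 0 T,
      LipschitzWith 1 ⇑(exp (t • hA.yosida (hl n))) := fun n t ht =>
    AddMonoidHomClass.lipschitz_of_bound_nnnorm _ 1 fun z => by
      rw [one_mul]
      exact norm_exp_smul_apply_le (hA.inner_yosida_nonpos (hl n)) ht.1 z
  refine hA.dense_domain.induction (P := fun x =>
    UniformCauchySeqOn (fun n t => exp (t • hA.yosida (hl n)) x) atTop (Icc 0 T))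
    (fun x hx => ?_) (isClosed_setOf_uniformCauchySeqOn hlip) x
  have hcauchy : CauchySeq fun n => hA.yosida (hl n) x := by
    simp only [← hA.resolvent_apply_eq_yosida _ ⟨x, hx⟩]
    exact (hA.tendsto_resolvent hl hl₀ _).cauchySeq
  rw [Metric.uniformCauchySeqOn_iff]
  intro ε hε
  obtain ⟨N, hN⟩ := Metric.cauchySeq_iff.1 hcauchy (ε / (|T| + 1)) (by positivity)
  refine ⟨N, fun m hm n hn t ht => ?_⟩
  have htT : t ≤ |T| + 1 := by linarith [ht.2, le_abs_self T]
  calc dist (exp (t • hA.yosida (hl m)) x) (exp (t • hA.yosida (hl n)) x)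
      ≤ dist (hA.yosida (hl m) x) (hA.yosida (hl n) x) * t := by
        simpa only [dist_eq_norm] using norm_exp_smul_sub_le (hA.yosida_commute (hl m) (hl n))
          (hA.inner_yosida_nonpos (hl m)) (hA.inner_yosida_nonpos (hl n)) ht.1 x
    _ ≤ dist (hA.yosida (hl m) x) (hA.yosida (hl n) x) * (|T| + 1) := by gcongr
    _ < ε := (lt_div_iff₀ (by positivity)).1 (hN m hm n hn)

theorem exists_tendstoUniformlyOn_exp_yosida (hA : IsMDissipative A) (hl : ∀ n, 0 < l n)
    (hl₀ : Tendsto l atTop (𝓝 0)) (x₀ : X) :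
    ∃ x : ℝ → X, ∀ T, TendstoUniformlyOn (fun n t => exp (t • hA.yosida (hl n)) x₀) x atTop
      (Icc 0 T) := by
  have hlim : ∀ t : ℝ, 0 ≤ t → ∃ y, Tendsto (fun n => exp (t • hA.yosida (hl n)) x₀) atTop (𝓝 y) :=
    fun t ht => cauchySeq_tendsto_of_complete
      ((hA.uniformCauchySeqOn_exp_yosida hl hl₀ t x₀).cauchySeq (right_mem_Icc.2 ht))
  choose! x hx using hlim
  exact ⟨x, fun T => (hA.uniformCauchySeqOn_exp_yosida hl hl₀ T x₀).tendstoUniformlyOn_of_tendsto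
    fun t ht => hx t ht.1⟩

end YosidaLimit

theorem resolvent_integral_exp_mem_graph (hA : IsMDissipative A) {l : ℝ} (hl : 0 < l) (x : X)
    (t : ℝ) : (hA.resolvent hl (∫ s in 0..t, exp (s • hA.yosida hl) x),
      exp (t • hA.yosida hl) x - x) ∈ A.graph := by
  set B := hA.yosida hl
  have hcont := continuous_exp_smul_apply B x
  have hint : B (∫ s in 0..t, exp (s • B) x) = exp (t • B) x - x := by
    rw [← B.intervalIntegral_comp_comm (hcont.intervalIntegrable _ _),
      intervalIntegral.integral_eq_sub_of_hasDerivAt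
        (fun s _ => hasDerivAt_exp_smul_apply B x s)
        ((B.continuous.comp hcont).intervalIntegrable _ _)]
    simp
  exact hint ▸ hA.resolvent_yosida_mem_graph hl _

theorem exists_isMildSolution (hA : IsMDissipative A) (x₀ : X) :
    ∃ x : ℝ → X, IsMildSolution A x ∧ x 0 = x₀ := by
  have hl : ∀ n : ℕ, (0 : ℝ) < 1 / ((n : ℝ) + 1) := fun n => Nat.one_div_pos_of_nat
  have hl₀ := tendsto_one_div_add_atTop_nhds_zero_nat (𝕜 := ℝ)
  obtain ⟨x, hx⟩ := hA.exists_tendstoUniformlyOn_exp_yosida hl hl₀ x₀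
  have hexp : ∀ n, Continuous fun t : ℝ => exp (t • hA.yosida (hl n)) x₀ := fun n =>
    continuous_exp_smul_apply _ x₀
  have hx₀ : x 0 = x₀ := tendsto_nhds_unique
    ((hx 0).tendsto_at (left_mem_Icc.2 le_rfl)) (by simp)
  refine ⟨x, ⟨?_, fun t ht => ?_⟩, hx₀⟩
  · refine continuousOn_of_locally_continuousOn fun t _ => ⟨Iio (t + 1), isOpen_Iio, by simp, ?_⟩
    exact ((hx (t + 1)).continuousOn (.of_forall fun n => (hexp n).continuousOn)).mono
      fun s hs => ⟨hs.1, hs.2.le⟩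
  · have hint : Tendsto (fun n => ∫ s in 0..t, exp (s • hA.yosida (hl n)) x₀) atTop
        (𝓝 (∫ s in 0..t, x s)) :=
      TendstoUniformlyOn.tendsto_intervalIntegral_of_continuousOn
        (.of_forall fun n => (hexp n).continuousOn) (by simpa only [uIcc_of_le ht] using hx t)
    refine hA.isClosed.mem_of_tendsto
      ((hA.tendsto_resolvent_of_tendsto hl hl₀ hint).prodMk_nhds
        (((hx t).tendsto_at (right_mem_Icc.2 ht)).sub_const (x 0)))
      (.of_forall fun n => hx₀ ▸ hA.resolvent_integral_exp_mem_graph (hl n) (x 0) t)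

end IsMDissipative

namespace IsMildSolution

variable {A : X →ₗ.[ℝ] X} [CompleteSpace X] {x y : ℝ → X}

theorem eqOn_of_isMDissipative (hA : IsMDissipative A) (hx : IsMildSolution A x)
    (hy : IsMildSolution A y) (h₀ : x 0 = y 0) : EqOn x y (Ici 0) := by
  -- The primitive `z` of `w = x - y` solves `z' = A z`, so `‖z‖` is nonincreasing.
  set w : ℝ → X := fun t => x t - y t
  have hw : ContinuousOn w (Ici 0) := hx.continuousOn.sub hy.continuousOn
  set z : ℝ → X := fun t => ∫ s in 0..t, w s
  have hzw : ∀ t, 0 ≤ t → (z t, w t) ∈ A.graph := fun t ht => by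
    have hIcc : uIcc 0 t ⊆ Ici 0 := uIcc_of_le ht ▸ Icc_subset_Ici_self
    have hsub := A.graph.sub_mem (hx.integral_mem_graph t ht) (hy.integral_mem_graph t ht)
    rw [Prod.mk_sub_mk, h₀, sub_sub_sub_cancel_right, ← intervalIntegral.integral_sub
      (hx.continuousOn.mono hIcc).intervalIntegrable
      (hy.continuousOn.mono hIcc).intervalIntegrable] at hsub
    exact hsub
  have hz : ∀ t, 0 ≤ t → z t = 0 := fun t ht => by
    have hanti := antitoneOn_Ici_of_hasDerivAt_nonpos ((continuousOn_integral_Ici hw).norm.pow 2)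
      (fun s hs => (hasDerivAt_integral_of_continuousOn_Ici hw hs).norm_sq) (fun s hs => by
        rw [real_inner_comm]
        linarith [hA.inner_nonpos_of_mem_graph (hzw s hs.le)])
    have hle : ‖z t‖ ^ 2 ≤ 0 := by simpa using hanti self_mem_Ici ht ht
    exact norm_eq_zero.1 (pow_eq_zero_iff two_ne_zero |>.1 (hle.antisymm (sq_nonneg _)))
  exact fun t ht => sub_eq_zero.1 (A.graph_fst_eq_zero_snd (hzw t ht) (hz t ht))

theorem hasDerivAt_resolvent (hA : IsMDissipative A) (hx : IsMildSolution A x) {l : ℝ}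
    (hl : 0 < l) {t : ℝ} (ht : 0 < t) :
    HasDerivAt (fun s => hA.resolvent hl (x s)) (hA.yosida hl (x t)) t := by
  refine (((hA.yosida hl).hasFDerivAt.comp_hasDerivAt t
    (hasDerivAt_integral_of_continuousOn_Ici hx.continuousOn ht)).const_add
    (hA.resolvent hl (x 0))).congr_of_eventuallyEq ?_
  filter_upwards [lt_mem_nhds ht] with s hs
  have h := hA.resolvent_eq_yosida_of_mem_graph hl (hx.integral_mem_graph s hs.le)
  rw [map_sub] at h
  rw [Function.comp_apply, ← h, add_sub_cancel]

variable {Y : Type*} [NormedAddCommGroup Y] [NormedSpace ℝ Y] {P : X →L[ℝ] Y}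

theorem norm_sq_resolvent_sub (hA : IsMDissipative A)
    (hP : ∀ x : A.domain, inner ℝ (A x) (x : X) = -‖P x‖ ^ 2) (hx : IsMildSolution A x) {l : ℝ}
    (hl : 0 < l) {t : ℝ} (ht : 0 ≤ t) :
    ‖hA.resolvent hl (x t)‖ ^ 2 - ‖hA.resolvent hl (x 0)‖ ^ 2 =
      ∫ s in 0..t, -(2 * ‖P (hA.resolvent hl (x s))‖ ^ 2) := by
  have hJ : ContinuousOn (fun s => hA.resolvent hl (x s)) (Icc 0 t) :=
    (hA.resolvent hl).continuous.comp_continuousOn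
      (hx.continuousOn.mono Icc_subset_Ici_self)
  refine (intervalIntegral.integral_eq_sub_of_hasDerivAt_of_le ht (hJ.norm.pow 2)
    (fun s hs => ((hx.hasDerivAt_resolvent hA hl hs.1).norm_sq).congr_deriv ?_) ?_).symm
  · obtain ⟨w, hw, hAw⟩ := A.mem_graph_iff.1 (hA.resolvent_yosida_mem_graph hl (x s))
    have h := hP w
    rw [hw, hAw] at h
    rw [real_inner_comm, h]
    ring
  · refine ContinuousOn.intervalIntegrable ?_
    rw [uIcc_of_le ht]
    exact ((P.continuous.comp_continuousOn hJ).norm.pow 2).const_mul 2 |>.neg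

/-- Mild solutions satisfy the energy identity of strong solutions, by passing to the limit in the
one for their images under the resolvents. -/
theorem norm_sq_sub (hA : IsMDissipative A)
    (hP : ∀ x : A.domain, inner ℝ (A x) (x : X) = -‖P x‖ ^ 2) (hx : IsMildSolution A x) {t : ℝ}
    (ht : 0 ≤ t) : ‖x t‖ ^ 2 - ‖x 0‖ ^ 2 = ∫ s in 0..t, -(2 * ‖P (x s)‖ ^ 2) := by
  have hl : ∀ n : ℕ, (0 : ℝ) < 1 / ((n : ℝ) + 1) := fun n => Nat.one_div_pos_of_nat
  have hJ : ∀ z, Tendsto (fun n => hA.resolvent (hl n) z) atTop (𝓝 z) :=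
    hA.tendsto_resolvent hl tendsto_one_div_add_atTop_nhds_zero_nat
  have hcont : ContinuousOn x (uIcc 0 t) :=
    hx.continuousOn.mono (uIcc_of_le ht ▸ Icc_subset_Ici_self)
  have hint : Tendsto (fun n => ∫ s in 0..t, -(2 * ‖P (hA.resolvent (hl n) (x s))‖ ^ 2)) atTop
      (𝓝 (∫ s in 0..t, -(2 * ‖P (x s)‖ ^ 2))) := by
    refine intervalIntegral.tendsto_integral_filter_of_dominated_convergence
      (fun s => 2 * (‖P‖ * ‖x s‖) ^ 2) (.of_forall fun n => ?_) (.of_forall fun n => ?_) ?_ ?_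
    · have hc : ContinuousOn (fun s => -(2 * ‖P (hA.resolvent (hl n) (x s))‖ ^ 2)) (uIcc 0 t) :=
        (((P.continuous.comp (hA.resolvent (hl n)).continuous).comp_continuousOn hcont).norm.pow
          2).const_mul 2 |>.neg
      exact (hc.mono uIoc_subset_uIcc).aestronglyMeasurable measurableSet_uIoc
    · refine .of_forall fun s _ => ?_
      rw [norm_neg, Real.norm_of_nonneg (by positivity)]
      gcongr
      exact (P.le_opNorm _).trans (by gcongr; exact hA.norm_resolvent_le _ _)
    · exact (((hcont.norm.const_mul ‖P‖).pow 2).const_mul 2).intervalIntegrable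
    · exact .of_forall fun s _ =>
        ((((P.continuous.tendsto _).comp (hJ (x s))).norm.pow 2).const_mul 2).neg
  refine tendsto_nhds_unique (((hJ (x t)).norm.pow 2).sub ((hJ (x 0)).norm.pow 2)) ?_
  simpa only [hx.norm_sq_resolvent_sub hA hP _ ht] using hint

theorem hasDerivAt_norm_sq (hA : IsMDissipative A)
    (hP : ∀ x : A.domain, inner ℝ (A x) (x : X) = -‖P x‖ ^ 2) (hx : IsMildSolution A x) {t : ℝ}
    (ht : 0 < t) : HasDerivAt (fun s => ‖x s‖ ^ 2) (-(2 * ‖P (x t)‖ ^ 2)) t := by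
  have hcont : ContinuousOn (fun s => -(2 * ‖P (x s)‖ ^ 2)) (Ici 0) :=
    ((P.continuous.comp_continuousOn hx.continuousOn).norm.pow 2).const_mul 2 |>.neg
  refine ((hasDerivAt_integral_of_continuousOn_Ici hcont ht).const_add
    (‖x 0‖ ^ 2)).congr_of_eventuallyEq ?_
  filter_upwards [lt_mem_nhds ht] with s hs
  rw [← hx.norm_sq_sub hA hP hs.le, add_sub_cancel]

end IsMildSolution

end MDissipative

section AbstractDampedWave

variable {H K : Type*} [NormedAddCommGroup H] [InnerProductSpace ℝ H] [NormedAddCommGroup K]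
  [InnerProductSpace ℝ K] {D : H →ₗ.[ℝ] K}

/-- Solutions on `[0, ∞)` of the damped wave equation `u'' + D†Du + u' = 0`, where `v = u'` and
`F = Du`; the equation is tested against the domain of `D`. -/
structure IsDampedWaveSolution (D : H →ₗ.[ℝ] K) (u v : ℝ → H) (F : ℝ → K) : Prop where
  mem_graph : ∀ t, 0 ≤ t → (u t, F t) ∈ D.graph
  continuousOn_operator : ContinuousOn F (Ici 0)
  hasDerivWithinAt : ∀ t, 0 ≤ t → HasDerivWithinAt u (v t) (Ici 0) t
  continuousOn_deriv : ContinuousOn v (Ici 0)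
  equation : ∀ φ : D.domain, ∀ t, 0 < t → HasDerivAt (fun s => inner ℝ (v s) (φ : H))
    (-(inner ℝ (F t) (D φ) + inner ℝ (v t) (φ : H))) t

namespace IsDampedWaveSolution

variable {u v : ℝ → H} {F : ℝ → K}

theorem continuousOn (h : IsDampedWaveSolution D u v F) : ContinuousOn u (Ici 0) := fun t ht =>
  (h.hasDerivWithinAt t ht).continuousWithinAt

theorem hasDerivAt (h : IsDampedWaveSolution D u v F) {t : ℝ} (ht : 0 < t) :
    HasDerivAt u (v t) t :=
  (h.hasDerivWithinAt t ht.le).hasDerivAt (Ici_mem_nhds ht)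

theorem continuousOn_toLp (h : IsDampedWaveSolution D u v F) :
    ContinuousOn (fun t => WithLp.toLp 2 (v t, F t)) (Ici 0) :=
  (WithLp.prod_continuous_toLp 2 H K).comp_continuousOn
    (h.continuousOn_deriv.prodMk h.continuousOn_operator)

end IsDampedWaveSolution

variable [CompleteSpace H]

theorem mem_graph_adjoint_iff (hD : Dense (D.domain : Set H)) {F : K} {w : H} :
    (F, w) ∈ D.adjoint.graph ↔
      ∀ φ : D.domain, inner ℝ w (φ : H) = inner ℝ F (D φ) := by
  constructor
  · intro h φ
    obtain ⟨F, rfl, rfl⟩ := D.adjoint.mem_graph_iff.1 h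
    exact LinearPMap.adjoint_isFormalAdjoint hD F φ
  · intro h
    have hF := LinearPMap.mem_adjoint_domain_of_exists F ⟨w, h⟩
    simpa only [LinearPMap.adjoint_apply_eq hD ⟨F, hF⟩ h] using D.adjoint.mem_graph ⟨F, hF⟩

/-- The generator `(v, F) ↦ (-D†F - v, Dv)` of the damped wave equation `u'' + D†Du + u' = 0`,
read as a first order system for `v = u'` and `F = Du`. -/
def waveGenerator (D : H →ₗ.[ℝ] K) : WithLp 2 (H × K) →ₗ.[ℝ] WithLp 2 (H × K) where
  domain := D.domain.comap (WithLp.fstL 2 ℝ H K).toLinearMap ⊓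
    D.adjoint.domain.comap (WithLp.sndL 2 ℝ H K).toLinearMap
  toFun :=
    { toFun := fun x =>
        WithLp.toLp 2 (-D.adjoint ⟨x.1.snd, x.2.2⟩ - x.1.fst, D ⟨x.1.fst, x.2.1⟩)
      map_add' := fun x y => by
        refine WithLp.ofLp_injective 2 (Prod.ext ?_ ?_)
        · have hadd := D.adjoint.map_add ⟨x.1.snd, x.2.2⟩ ⟨y.1.snd, y.2.2⟩
          change -D.adjoint ⟨x.1.snd + y.1.snd, _⟩ - (x.1.fst + y.1.fst) =
            -D.adjoint ⟨x.1.snd, x.2.2⟩ - x.1.fst + (-D.adjoint ⟨y.1.snd, y.2.2⟩ - y.1.fst)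
          rw [show D.adjoint ⟨x.1.snd + y.1.snd, _⟩ = _ from hadd]
          abel
        · exact D.map_add ⟨x.1.fst, x.2.1⟩ ⟨y.1.fst, y.2.1⟩
      map_smul' := fun c x => by
        refine WithLp.ofLp_injective 2 (Prod.ext ?_ ?_)
        · have hsmul := D.adjoint.map_smul c ⟨x.1.snd, x.2.2⟩
          change -D.adjoint ⟨c • x.1.snd, _⟩ - c • x.1.fst =
            c • (-D.adjoint ⟨x.1.snd, x.2.2⟩ - x.1.fst)
          rw [smul_sub, smul_neg, ← hsmul]
          rfl
        · exact D.map_smul c ⟨x.1.fst, x.2.1⟩ }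

theorem mem_graph_waveGenerator (hD : Dense (D.domain : Set H)) {x y : WithLp 2 (H × K)} :
    (x, y) ∈ (waveGenerator D).graph ↔ (x.fst, y.snd) ∈ D.graph ∧
      ∀ φ : D.domain, inner ℝ (y.fst + x.fst) (φ : H) = -inner ℝ x.snd (D φ) := by
  have hadj : (∀ φ : D.domain, inner ℝ (y.fst + x.fst) (φ : H) = -inner ℝ x.snd (D φ)) ↔
      (x.snd, -(y.fst + x.fst)) ∈ D.adjoint.graph := by
    simp only [mem_graph_adjoint_iff hD, inner_neg_left, neg_eq_iff_eq_neg]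
  rw [hadj]
  constructor
  · intro h
    obtain ⟨x, rfl, rfl⟩ := (waveGenerator D).mem_graph_iff.1 h
    refine ⟨D.mem_graph ⟨x.1.fst, x.2.1⟩, ?_⟩
    change (x.1.snd, -(-D.adjoint ⟨x.1.snd, x.2.2⟩ - x.1.fst + x.1.fst)) ∈ D.adjoint.graph
    rw [sub_add_cancel, neg_neg]
    exact D.adjoint.mem_graph ⟨x.1.snd, x.2.2⟩
  · rintro ⟨hx, hy⟩
    have hx₁ := D.mem_domain_of_mem_graph hx
    have hx₂ := D.adjoint.mem_domain_of_mem_graph hy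
    refine (waveGenerator D).mem_graph_iff.2 ⟨⟨x, hx₁, hx₂⟩, rfl, ?_⟩
    have hDx := D.mem_graph_snd_inj hx (D.mem_graph ⟨x.fst, hx₁⟩) rfl
    have hDy := D.adjoint.mem_graph_snd_inj hy (D.adjoint.mem_graph ⟨x.snd, hx₂⟩) rfl
    refine WithLp.ofLp_injective 2 (Prod.ext ?_ hDx.symm)
    change -D.adjoint ⟨x.snd, hx₂⟩ - x.fst = y.fst
    rw [← hDy, neg_neg, add_sub_cancel_right]

theorem inner_waveGenerator (hD : Dense (D.domain : Set H)) (x : (waveGenerator D).domain) :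
    inner ℝ (waveGenerator D x) (x : WithLp 2 (H × K)) =
      -‖WithLp.fstL 2 ℝ H K (x : WithLp 2 (H × K))‖ ^ 2 := by
  obtain ⟨-, h⟩ := (mem_graph_waveGenerator hD).1 ((waveGenerator D).mem_graph x)
  have hx := h ⟨x.1.fst, x.2.1⟩
  rw [inner_add_left, real_inner_self_eq_norm_sq] at hx
  change inner ℝ (waveGenerator D x).fst x.1.fst +
    inner ℝ (D ⟨x.1.fst, x.2.1⟩) x.1.snd = -‖x.1.fst‖ ^ 2
  rw [real_inner_comm x.1.snd]
  linarith

theorem exists_inner_add_inner_eq [CompleteSpace K] (hD : D.IsClosed) {c : ℝ} (hc : 0 < c)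
    (a : H) (f : K) : ∃ v : D.domain, ∀ φ : D.domain,
      c * inner ℝ (v : H) (φ : H) + inner ℝ (D v) (D φ) = inner ℝ a (φ : H) + inner ℝ f (D φ) := by
  -- Project `(a / √c, f)` onto the closed subspace of all `(√c v, D v)`.
  obtain ⟨s, hs, rfl⟩ : ∃ s : ℝ, 0 < s ∧ s ^ 2 = c := ⟨√c, Real.sqrt_pos.2 hc, Real.sq_sqrt hc.le⟩
  let S : WithLp 2 (H × K) →L[ℝ] H × K :=
    (s⁻¹ • WithLp.fstL 2 ℝ H K).prod (WithLp.sndL 2 ℝ H K)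
  let N : Submodule ℝ (WithLp 2 (H × K)) := D.graph.comap S.toLinearMap
  have : CompleteSpace N := (hD.preimage S.continuous).completeSpace_coe
  let q : WithLp 2 (H × K) := WithLp.toLp 2 (s⁻¹ • a, f)
  obtain ⟨v, hv, hDv⟩ := D.mem_graph_iff.1 (N.starProjection_apply_mem q)
  refine ⟨v, fun φ => ?_⟩
  have hφ : WithLp.toLp 2 (s • (φ : H), D φ) ∈ N := by
    change (s⁻¹ • s • (φ : H), D φ) ∈ D.graph
    rw [inv_smul_smul₀ hs.ne']
    exact D.mem_graph φ
  have horth : inner ℝ (s⁻¹ • a - (N.starProjection q).fst) (s • (φ : H)) +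
      inner ℝ (f - (N.starProjection q).snd) (D φ) = 0 :=
    N.starProjection_inner_eq_zero q _ hφ
  have hfst : (N.starProjection q).fst = s • (v : H) := by
    rw [hv]
    exact (smul_inv_smul₀ hs.ne' _).symm
  have hsnd : (N.starProjection q).snd = D v := hDv.symm
  rw [hfst, hsnd] at horth
  simp only [inner_sub_left, real_inner_smul_left, inner_smul_right] at horth
  field_simp at horth
  linarith

theorem isMDissipative_waveGenerator [CompleteSpace K] (hD : D.IsClosed)
    (hD' : Dense (D.domain : Set H)) : IsMDissipative (waveGenerator D) where
  inner_nonpos x := by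
    rw [inner_waveGenerator hD']
    exact neg_nonpos.2 (sq_nonneg _)
  surjective l hl z := by
    -- Eliminating `F = z₂ + l Dv` from `(1 - lA)(v, F) = z` leaves a coercive equation for `v`.
    obtain ⟨v, hv⟩ := exists_inner_add_inner_eq hD (c := (1 + l) / l ^ 2) (by positivity)
      ((l ^ 2)⁻¹ • z.fst) (-l⁻¹ • z.snd)
    have hgraph : (WithLp.toLp 2 ((v : H), z.snd + l • D v),
        WithLp.toLp 2 (l⁻¹ • ((v : H) - z.fst), D v)) ∈ (waveGenerator D).graph := by
      refine (mem_graph_waveGenerator hD').2 ⟨D.mem_graph v, fun φ => ?_⟩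
      have hvφ := hv φ
      change inner ℝ (l⁻¹ • ((v : H) - z.fst) + v) (φ : H) = -inner ℝ (z.snd + l • D v) (D φ)
      simp only [inner_add_left, inner_sub_left, real_inner_smul_left] at hvφ ⊢
      field_simp at hvφ ⊢
      linarith
    obtain ⟨x, hx, hAx⟩ := (waveGenerator D).mem_graph_iff.1 hgraph
    refine ⟨x, ?_⟩
    simp only [hx, hAx]
    refine WithLp.ofLp_injective 2 (Prod.ext ?_ ?_)
    · change (v : H) - l • l⁻¹ • ((v : H) - z.fst) = z.fst
      rw [smul_inv_smul₀ hl.ne', sub_sub_cancel]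
    · exact add_sub_cancel_right z.snd (l • D v)

theorem IsMildSolution.isDampedWaveSolution [CompleteSpace K] (hD : Dense (D.domain : Set H))
    {x : ℝ → WithLp 2 (H × K)} (hx : IsMildSolution (waveGenerator D) x) {u₀ : H}
    (h₀ : (u₀, (x 0).snd) ∈ D.graph) :
    IsDampedWaveSolution D (fun t => u₀ + ∫ s in 0..t, (x s).fst) (fun t => (x t).fst)
      (fun t => (x t).snd) := by
  have hfst : ContinuousOn (fun t => (x t).fst) (Ici 0) :=
    (WithLp.fstL 2 ℝ H K).continuous.comp_continuousOn hx.continuousOn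
  have hsnd : ContinuousOn (fun t => (x t).snd) (Ici 0) :=
    (WithLp.sndL 2 ℝ H K).continuous.comp_continuousOn hx.continuousOn
  have hgraph : ∀ t, 0 ≤ t → (∫ s in 0..t, (x s).fst, (x t).snd - (x 0).snd) ∈ D.graph ∧
      ∀ φ : D.domain, inner ℝ ((x t).fst - (x 0).fst + ∫ s in 0..t, (x s).fst) (φ : H) =
        -inner ℝ (∫ s in 0..t, (x s).snd) (D φ) := fun t ht => by
    have hint : IntervalIntegrable x volume 0 t :=
      (hx.continuousOn.mono (uIcc_of_le ht ▸ Icc_subset_Ici_self)).intervalIntegrable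
    have h := (mem_graph_waveGenerator hD).1 (hx.integral_mem_graph t ht)
    have hIfst : (∫ s in 0..t, x s).fst = ∫ s in 0..t, (x s).fst :=
      ((WithLp.fstL 2 ℝ H K).intervalIntegral_comp_comm hint).symm
    have hIsnd : (∫ s in 0..t, x s).snd = ∫ s in 0..t, (x s).snd :=
      ((WithLp.sndL 2 ℝ H K).intervalIntegral_comp_comm hint).symm
    rwa [hIfst, hIsnd] at h
  refine ⟨fun t ht => ?_, hsnd, fun t ht => (hasDerivWithinAt_integral_Ici hfst ht).const_add u₀,
    hfst, fun φ t ht => ?_⟩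
  · simpa using D.graph.add_mem h₀ (hgraph t ht).1
  · have hd := ((hasDerivAt_const t (inner ℝ (x 0).fst (φ : H))).sub
      ((hasDerivAt_integral_of_continuousOn_Ici hfst ht).inner ℝ
        (hasDerivAt_const t (φ : H)))).sub
      ((hasDerivAt_integral_of_continuousOn_Ici hsnd ht).inner ℝ (hasDerivAt_const t (D φ)))
    refine (hd.congr_deriv ?_).congr_of_eventuallyEq ?_
    · simp only [inner_zero_right]
      ring
    · filter_upwards [lt_mem_nhds ht] with s hs
      have h := (hgraph s hs.le).2 φ
      rw [inner_add_left, inner_sub_left] at h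
      simp only [Pi.sub_apply]
      linarith

theorem exists_isDampedWaveSolution [CompleteSpace K] (hD : D.IsClosed)
    (hD' : Dense (D.domain : Set H)) (u₀ : D.domain) (v₀ : H) :
    ∃ u v F, IsDampedWaveSolution D u v F ∧ u 0 = u₀ ∧ v 0 = v₀ := by
  obtain ⟨x, hx, hx₀⟩ :=
    (isMDissipative_waveGenerator hD hD').exists_isMildSolution (WithLp.toLp 2 (v₀, D u₀))
  refine ⟨_, _, _, hx.isDampedWaveSolution hD' (u₀ := u₀) ?_, ?_, ?_⟩
  · rw [hx₀]
    exact D.mem_graph u₀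
  · simp only [intervalIntegral.integral_same, add_zero]
  · exact congrArg WithLp.fst hx₀

namespace IsDampedWaveSolution

variable {u u' v v' : ℝ → H} {F F' : ℝ → K}

theorem integral_deriv (h : IsDampedWaveSolution D u v F) {t : ℝ} (ht : 0 ≤ t) :
    ∫ s in 0..t, v s = u t - u 0 :=
  intervalIntegral.integral_eq_sub_of_hasDerivAt_of_le ht (h.continuousOn.mono Icc_subset_Ici_self)
    (fun _ hs => h.hasDerivAt hs.1)
    (h.continuousOn_deriv.mono (uIcc_of_le ht ▸ Icc_subset_Ici_self)).intervalIntegrable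

theorem inner_integral_operator [CompleteSpace K] (h : IsDampedWaveSolution D u v F)
    (φ : D.domain) {t : ℝ} (ht : 0 ≤ t) :
    inner ℝ (v t + u t - (v 0 + u 0)) (φ : H) = -inner ℝ (∫ s in 0..t, F s) (D φ) := by
  have hIcc : uIcc 0 t ⊆ Ici 0 := uIcc_of_le ht ▸ Icc_subset_Ici_self
  have hF := h.continuousOn_operator.mono hIcc
  have hv := h.continuousOn_deriv.mono hIcc
  have hint := intervalIntegral.integral_eq_sub_of_hasDerivAt_of_le ht
    (uIcc_of_le ht ▸ hv.inner continuousOn_const) (fun s hs => h.equation φ s hs.1)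
    ((hF.inner continuousOn_const).add (hv.inner continuousOn_const)).neg.intervalIntegrable
  have hFφ : ∫ s in 0..t, inner ℝ (F s) (D φ) = inner ℝ (∫ s in 0..t, F s) (D φ) :=
    ((innerSL ℝ).flip (D φ)).intervalIntegral_comp_comm hF.intervalIntegrable
  have hvφ : ∫ s in 0..t, inner ℝ (v s) (φ : H) = inner ℝ (∫ s in 0..t, v s) (φ : H) :=
    ((innerSL ℝ).flip (φ : H)).intervalIntegral_comp_comm hv.intervalIntegrable
  rw [intervalIntegral.integral_neg, intervalIntegral.integral_add
    (hF.inner continuousOn_const).intervalIntegrable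
    (hv.inner continuousOn_const).intervalIntegrable, hFφ, hvφ, h.integral_deriv ht,
    inner_sub_left] at hint
  rw [inner_sub_left, inner_add_left, inner_add_left]
  linarith

theorem isMildSolution [CompleteSpace K] (hD : Dense (D.domain : Set H))
    (h : IsDampedWaveSolution D u v F) :
    IsMildSolution (waveGenerator D) fun t => WithLp.toLp 2 (v t, F t) where
  continuousOn := h.continuousOn_toLp
  integral_mem_graph t ht := by
    have hint : IntervalIntegrable (fun t => WithLp.toLp 2 (v t, F t)) volume 0 t :=
      (h.continuousOn_toLp.mono (uIcc_of_le ht ▸ Icc_subset_Ici_self)).intervalIntegrable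
    have hfst : (∫ s in 0..t, WithLp.toLp 2 (v s, F s)).fst = u t - u 0 :=
      ((WithLp.fstL 2 ℝ H K).intervalIntegral_comp_comm hint).symm.trans (h.integral_deriv ht)
    have hsnd : (∫ s in 0..t, WithLp.toLp 2 (v s, F s)).snd = ∫ s in 0..t, F s :=
      ((WithLp.sndL 2 ℝ H K).intervalIntegral_comp_comm hint).symm
    rw [mem_graph_waveGenerator hD, hfst, hsnd]
    refine ⟨D.graph.sub_mem (h.mem_graph t ht) (h.mem_graph 0 le_rfl), fun φ => ?_⟩
    rw [← h.inner_integral_operator φ ht]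
    congr 1
    change v t - v 0 + (u t - u 0) = _
    abel

theorem eqOn [CompleteSpace K] (hD : D.IsClosed) (hD' : Dense (D.domain : Set H))
    (h : IsDampedWaveSolution D u v F) (h' : IsDampedWaveSolution D u' v' F')
    (hu : u 0 = u' 0) (hv : v 0 = v' 0) :
    EqOn u u' (Ici 0) ∧ EqOn v v' (Ici 0) ∧ EqOn F F' (Ici 0) := by
  have hF : F 0 = F' 0 :=
    D.mem_graph_snd_inj (h.mem_graph 0 le_rfl) (h'.mem_graph 0 le_rfl) hu
  have heq := (h.isMildSolution hD').eqOn_of_isMDissipative (isMDissipative_waveGenerator hD hD')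
    (h'.isMildSolution hD') (by simp only [hv, hF])
  have hvv : EqOn v v' (Ici 0) := fun t ht => congrArg WithLp.fst (heq ht)
  refine ⟨fun t ht => ?_, hvv, fun t ht => congrArg WithLp.snd (heq ht)⟩
  have hint : ∫ s in 0..t, v s = ∫ s in 0..t, v' s :=
    intervalIntegral.integral_congr fun s hs => hvv ((uIcc_of_le ht).subset.trans
      Icc_subset_Ici_self hs)
  rwa [h.integral_deriv ht, h'.integral_deriv ht, hu, sub_left_inj] at hint

theorem integral_mem_graph [CompleteSpace K] (hD : D.IsClosed) (h : IsDampedWaveSolution D u v F)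
    {t : ℝ} (ht : 0 ≤ t) : (∫ s in 0..t, u s, ∫ s in 0..t, F s) ∈ D.graph := by
  have hIcc : uIcc 0 t ⊆ Ici 0 := uIcc_of_le ht ▸ Icc_subset_Ici_self
  have hint : IntervalIntegrable (fun s => (u s, F s)) volume 0 t :=
    ((h.continuousOn.prodMk h.continuousOn_operator).mono hIcc).intervalIntegrable
  have hpair : ∫ s in 0..t, (u s, F s) = (∫ s in 0..t, u s, ∫ s in 0..t, F s) :=
    Prod.ext ((ContinuousLinearMap.fst ℝ H K).intervalIntegral_comp_comm hint).symm
      ((ContinuousLinearMap.snd ℝ H K).intervalIntegral_comp_comm hint).symm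
  exact hpair ▸ intervalIntegral_mem hD hint fun s hs => h.mem_graph s (hIcc hs)

end IsDampedWaveSolution

end AbstractDampedWave

section Decay

variable {H K : Type*} [NormedAddCommGroup H] [InnerProductSpace ℝ H] [NormedAddCommGroup K]
  [InnerProductSpace ℝ K] {D : H →ₗ.[ℝ] K}

/-- The energy `½ (‖u'‖² + ‖Du‖²)` of the damped wave equation, as a function of time. -/
def waveEnergy (v : ℝ → H) (F : ℝ → K) (t : ℝ) : ℝ :=
  1 / 2 * (‖v t‖ ^ 2 + ‖F t‖ ^ 2)

/-- The functional produced by the multiplier `u`, with `v = u'`. -/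
def waveVirial (u v : ℝ → H) (t : ℝ) : ℝ :=
  inner ℝ (v t) (u t) + 1 / 2 * ‖u t‖ ^ 2

/-- The energy of the time primitive `U = ∫₀ᵗ u`, which solves
`U'' + D†DU + U' = u(0) + u'(0)`. -/
def primitiveEnergy (u v : ℝ → H) (F : ℝ → K) (t : ℝ) : ℝ :=
  1 / 2 * (‖u t‖ ^ 2 + ‖∫ s in 0..t, F s‖ ^ 2) - inner ℝ (v 0 + u 0) (∫ s in 0..t, u s)

/-- The Lyapunov functional of the damped wave equation. Its weights make the terms of its
derivative that grow in `t` cancel, up to `-(1 + t)² ‖u'‖²`. -/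
def waveLyapunov (u v : ℝ → H) (F : ℝ → K) (t : ℝ) : ℝ :=
  (1 + t) ^ 2 * waveEnergy v F t + (1 + t) * (waveVirial u v t + 2 * waveEnergy v F t) +
    waveVirial u v t + 3 * waveEnergy v F t + primitiveEnergy u v F t

namespace IsDampedWaveSolution

variable {u v : ℝ → H} {F : ℝ → K}

theorem hasDerivAt_waveVirial (h : IsDampedWaveSolution D u v F) {t : ℝ} (ht : 0 < t) :
    HasDerivAt (waveVirial u v) (‖v t‖ ^ 2 - ‖F t‖ ^ 2) t := by
  -- `v` is only weakly differentiable, but the product rule survives since `u` is `C¹`.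
  have hprod : HasDerivAt (fun s => inner ℝ (v s) (u s - u t)) (‖v t‖ ^ 2) t := by
    have hv : Tendsto v (𝓝[≠] t) (𝓝 (v t)) :=
      (h.continuousOn_deriv.continuousAt (Ici_mem_nhds ht)).tendsto.mono_left nhdsWithin_le_nhds
    rw [hasDerivAt_iff_tendsto_slope, ← real_inner_self_eq_norm_sq]
    refine (hv.inner (h.hasDerivAt ht).tendsto_slope).congr fun s => ?_
    simp [slope_def_module, inner_smul_right]
  obtain ⟨φ, hφ, hDφ⟩ := D.mem_graph_iff.1 (h.mem_graph t ht.le)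
  have heq := h.equation φ t ht
  rw [hφ, hDφ, real_inner_self_eq_norm_sq] at heq
  refine ((hprod.add heq).add ((h.hasDerivAt ht).norm_sq.const_mul (1 / 2))).congr_deriv ?_
    |>.congr_of_eventuallyEq (.of_forall fun s => ?_)
  · rw [real_inner_comm (u t) (v t)]
    ring
  · simp only [waveVirial, Pi.add_apply, inner_sub_right, sub_add_cancel]

variable [CompleteSpace H] [CompleteSpace K]

theorem hasDerivAt_waveEnergy (hD : D.IsClosed) (hD' : Dense (D.domain : Set H))
    (h : IsDampedWaveSolution D u v F) {t : ℝ} (ht : 0 < t) :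
    HasDerivAt (waveEnergy v F) (-‖v t‖ ^ 2) t := by
  have hd := (h.isMildSolution hD').hasDerivAt_norm_sq (isMDissipative_waveGenerator hD hD')
    (inner_waveGenerator hD') ht
  simp only [WithLp.prod_norm_sq_eq_of_L2] at hd
  refine (hd.const_mul (1 / 2)).congr_deriv ?_
  change 1 / 2 * -(2 * ‖v t‖ ^ 2) = _
  ring

theorem hasDerivAt_primitiveEnergy (h : IsDampedWaveSolution D u v F) {t : ℝ} (ht : 0 < t) :
    HasDerivAt (primitiveEnergy u v F) (-‖u t‖ ^ 2) t := by
  obtain ⟨φ, hφ, hDφ⟩ := D.mem_graph_iff.1 (h.mem_graph t ht.le)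
  have heq := h.inner_integral_operator φ ht.le
  rw [hφ, hDφ, inner_sub_left, inner_add_left, real_inner_self_eq_norm_sq,
    real_inner_comm (u t) (v t)] at heq
  refine ((((h.hasDerivAt ht).norm_sq.add
    (hasDerivAt_integral_of_continuousOn_Ici h.continuousOn_operator ht).norm_sq).const_mul
    (1 / 2)).sub ((hasDerivAt_const t (v 0 + u 0)).inner ℝ
    (hasDerivAt_integral_of_continuousOn_Ici h.continuousOn ht))).congr_deriv ?_
  rw [inner_zero_left]
  linarith

theorem continuousOn_waveLyapunov (h : IsDampedWaveSolution D u v F) :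
    ContinuousOn (waveLyapunov u v F) (Ici 0) := by
  have hu := h.continuousOn
  have hv := h.continuousOn_deriv
  have hF := h.continuousOn_operator
  have hIu := continuousOn_integral_Ici hu
  have hIF := continuousOn_integral_Ici hF
  unfold waveLyapunov waveVirial waveEnergy primitiveEnergy
  fun_prop

theorem hasDerivAt_waveLyapunov (hD : D.IsClosed) (hD' : Dense (D.domain : Set H))
    (h : IsDampedWaveSolution D u v F) {t : ℝ} (ht : 0 < t) :
    HasDerivAt (waveLyapunov u v F)
      (inner ℝ (v t) (u t) - 1 / 2 * ‖u t‖ ^ 2 - ‖v t‖ ^ 2 - (1 + t) ^ 2 * ‖v t‖ ^ 2) t := by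
  have hlin : HasDerivAt (fun s : ℝ => 1 + s) 1 t := (hasDerivAt_id t).const_add 1
  have hE := h.hasDerivAt_waveEnergy hD hD' ht
  have hY := h.hasDerivAt_waveVirial ht
  refine ((((((hlin.pow 2).mul hE).add (hlin.mul (hY.add (hE.const_mul 2)))).add hY).add
    (hE.const_mul 3)).add (h.hasDerivAt_primitiveEnergy ht)).congr_deriv ?_
  simp only [waveEnergy, waveVirial, Pi.add_apply, Pi.pow_apply]
  ring

theorem antitoneOn_waveLyapunov (hD : D.IsClosed) (hD' : Dense (D.domain : Set H))
    (h : IsDampedWaveSolution D u v F) : AntitoneOn (waveLyapunov u v F) (Ici 0) := by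
  refine antitoneOn_Ici_of_hasDerivAt_nonpos h.continuousOn_waveLyapunov
    (fun t ht => h.hasDerivAt_waveLyapunov hD hD' ht) fun t _ => ?_
  nlinarith [real_inner_le_norm (v t) (u t), sq_nonneg (‖v t‖ - ‖u t‖), sq_nonneg ‖v t‖,
    mul_nonneg (sq_nonneg (1 + t)) (sq_nonneg ‖v t‖)]

theorem le_waveLyapunov (hD : D.IsClosed) (h : IsDampedWaveSolution D u v F) {κ : ℝ}
    (hκ : ∀ φ : D.domain, 2 * inner ℝ (v 0 + u 0) (φ : H) ≤ κ + ‖D φ‖ ^ 2) {t : ℝ} (ht : 0 ≤ t) :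
    (1 + t) ^ 2 * waveEnergy v F t + 1 / 4 * (1 + t) * ‖u t‖ ^ 2 - κ / 2 ≤
      waveLyapunov u v F t := by
  have hinner : 0 ≤ inner ℝ (v t) (u t) + ‖v t‖ ^ 2 + 1 / 4 * ‖u t‖ ^ 2 := by
    nlinarith [neg_le_of_abs_le (abs_real_inner_le_norm (v t) (u t)),
      sq_nonneg (‖v t‖ - 1 / 2 * ‖u t‖)]
  obtain ⟨φ, hφ, hDφ⟩ := D.mem_graph_iff.1 (h.integral_mem_graph hD ht)
  have hprim : -(κ / 2) + 1 / 2 * ‖u t‖ ^ 2 ≤ primitiveEnergy u v F t := by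
    have := hκ φ
    rw [hφ, hDφ] at this
    simp only [primitiveEnergy]
    linarith
  simp only [waveLyapunov, waveVirial, waveEnergy]
  nlinarith [mul_nonneg (by linarith : 0 ≤ 1 + t) hinner, mul_nonneg ht (sq_nonneg ‖F t‖),
    sq_nonneg ‖F t‖, sq_nonneg ‖v t‖, sq_nonneg ‖u t‖]

theorem decay (hD : D.IsClosed) (hD' : Dense (D.domain : Set H))
    (h : IsDampedWaveSolution D u v F) {κ : ℝ}
    (hκ : ∀ φ : D.domain, 2 * inner ℝ (v 0 + u 0) (φ : H) ≤ κ + ‖D φ‖ ^ 2) {t : ℝ} (ht : 0 ≤ t) :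
    (1 + t) ^ 2 * waveEnergy v F t + 1 / 4 * (1 + t) * ‖u t‖ ^ 2 ≤
      4 * ‖v 0‖ ^ 2 + 3 * ‖F 0‖ ^ 2 + 5 / 2 * ‖u 0‖ ^ 2 + κ / 2 := by
  have hle := (h.le_waveLyapunov hD hκ ht).trans
    (h.antitoneOn_waveLyapunov hD hD' self_mem_Ici ht ht)
  have hinner := real_inner_le_norm (v 0) (u 0)
  have h₀ : waveLyapunov u v F 0 =
      3 * (‖v 0‖ ^ 2 + ‖F 0‖ ^ 2) + 2 * inner ℝ (v 0) (u 0) + 3 / 2 * ‖u 0‖ ^ 2 := by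
    simp only [waveLyapunov, waveVirial, waveEnergy, primitiveEnergy,
      intervalIntegral.integral_same, norm_zero, inner_zero_right]
    ring
  nlinarith [sq_nonneg (‖v 0‖ - ‖u 0‖)]

end IsDampedWaveSolution

end Decay

section BoundedPair

variable {H K L : Type*} [NormedAddCommGroup H] [InnerProductSpace ℝ H] [NormedAddCommGroup K]
  [InnerProductSpace ℝ K] [NormedAddCommGroup L] [InnerProductSpace ℝ L]
  {T : H →ₗ.[ℝ] K} {B : H →L[ℝ] L}

/-- The operator `f ↦ (T f, B f)` on the domain of `T`, for a bounded operator `B`. -/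
def pairOperator (T : H →ₗ.[ℝ] K) (B : H →L[ℝ] L) : H →ₗ.[ℝ] WithLp 2 (K × L) where
  domain := T.domain
  toFun := (WithLp.linearEquiv 2 ℝ (K × L)).symm.toLinearMap ∘ₗ
    T.toFun.prod (B.toLinearMap ∘ₗ T.domain.subtype)

theorem mem_graph_pairOperator {f : H} {F : WithLp 2 (K × L)} :
    (f, F) ∈ (pairOperator T B).graph ↔ (f, F.fst) ∈ T.graph ∧ F.snd = B f := by
  constructor
  · intro h
    obtain ⟨f, rfl, rfl⟩ := (pairOperator T B).mem_graph_iff.1 h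
    exact ⟨T.mem_graph f, rfl⟩
  · rintro ⟨hT, hB⟩
    obtain ⟨f, rfl, hf⟩ := T.mem_graph_iff.1 hT
    exact (pairOperator T B).mem_graph_iff.2
      ⟨f, rfl, WithLp.ofLp_injective 2 (Prod.ext hf hB.symm)⟩

theorem isClosed_pairOperator (hT : T.IsClosed) : (pairOperator T B).IsClosed := by
  have hfst : Continuous fun p : H × WithLp 2 (K × L) => (p.1, p.2.fst) :=
    continuous_fst.prodMk ((WithLp.fstL 2 ℝ K L).continuous.comp continuous_snd)
  have hsnd : Continuous fun p : H × WithLp 2 (K × L) => p.2.snd :=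
    (WithLp.sndL 2 ℝ K L).continuous.comp continuous_snd
  have hgraph : ((pairOperator T B).graph : Set (H × WithLp 2 (K × L))) =
      (fun p => (p.1, p.2.fst)) ⁻¹' T.graph ∩ {p | p.2.snd = B p.1} :=
    Set.ext fun _ => mem_graph_pairOperator
  rw [LinearPMap.IsClosed, hgraph]
  exact (hT.preimage hfst).inter (isClosed_eq hsnd (B.continuous.comp continuous_fst))

end BoundedPair

section SquareIntegrable

variable {α : Type*} [MeasurableSpace α] {μ : Measure α}

theorem inner_eq_integral_mul (f g : Lp ℝ 2 μ) : inner ℝ f g = ∫ x, f x * g x ∂μ :=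
  integral_congr_ae (.of_forall fun x => mul_comm (g x) (f x))

theorem integrable_norm_sq {E : Type*} [NormedAddCommGroup E] (f : Lp E 2 μ) :
    Integrable (fun x => ‖f x‖ ^ 2) μ :=
  (Lp.memLp f).integrable_norm_pow two_ne_zero

theorem integral_norm_sq {E : Type*} [NormedAddCommGroup E] [InnerProductSpace ℝ E]
    (f : Lp E 2 μ) : ∫ x, ‖f x‖ ^ 2 ∂μ = ‖f‖ ^ 2 := by
  rw [← real_inner_self_eq_norm_sq, MeasureTheory.L2.inner_def]
  exact integral_congr_ae (.of_forall fun x => (real_inner_self_eq_norm_sq _).symm)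

variable [TopologicalSpace α] [OpensMeasurableSpace α] {V : α →ᵇ ℝ}

theorem memLp_top_sqrt (V : α →ᵇ ℝ) : MemLp (fun x => √(V x)) ⊤ μ := by
  refine memLp_top_of_bound V.continuous.sqrt.aestronglyMeasurable (√‖V‖) (.of_forall fun x => ?_)
  rw [Real.norm_of_nonneg (Real.sqrt_nonneg _)]
  exact Real.sqrt_le_sqrt ((le_abs_self _).trans (V.norm_coe_le_norm x))

/-- Multiplication by `√V` on `L²`. -/
def sqrtMul (V : α →ᵇ ℝ) : Lp ℝ 2 μ →L[ℝ] Lp ℝ 2 μ :=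
  (ContinuousLinearMap.mul ℝ ℝ).holderL μ ⊤ 2 2 (memLp_top_sqrt V).toLp

theorem coeFn_sqrtMul (V : α →ᵇ ℝ) (f : Lp ℝ 2 μ) : sqrtMul V f =ᵐ[μ] fun x => √(V x) * f x := by
  have hmul : sqrtMul V f =ᵐ[μ] fun x => (memLp_top_sqrt V).toLp _ x * f x :=
    (ContinuousLinearMap.mul ℝ ℝ).coeFn_holder (r := 2) (memLp_top_sqrt V).toLp f
  filter_upwards [hmul, (memLp_top_sqrt V).coeFn_toLp] with x hx hVx
  rw [hx, hVx]

theorem inner_sqrtMul (hV : ∀ x, 0 ≤ V x) (f g : Lp ℝ 2 μ) :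
    inner ℝ (sqrtMul V f) (sqrtMul V g) = ∫ x, V x * f x * g x ∂μ := by
  rw [inner_eq_integral_mul]
  refine integral_congr_ae ?_
  filter_upwards [coeFn_sqrtMul V f, coeFn_sqrtMul V g] with x hf hg
  rw [hf, hg, mul_mul_mul_comm, Real.mul_self_sqrt (hV x), mul_assoc]

theorem norm_sq_coeFn_sqrtMul (hV : ∀ x, 0 ≤ V x) (f : Lp ℝ 2 μ) :
    (fun x => ‖sqrtMul V f x‖ ^ 2) =ᵐ[μ] fun x => V x * |f x| ^ 2 := by
  filter_upwards [coeFn_sqrtMul V f] with x hx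
  rw [hx, norm_mul, mul_pow, Real.norm_of_nonneg (Real.sqrt_nonneg _), Real.sq_sqrt (hV x),
    Real.norm_eq_abs]

theorem integrable_mul_sq (hV : ∀ x, 0 ≤ V x) (f : Lp ℝ 2 μ) :
    Integrable (fun x => V x * |f x| ^ 2) μ :=
  (integrable_norm_sq (sqrtMul V f)).congr (norm_sq_coeFn_sqrtMul hV f)

theorem norm_sqrtMul_sq (hV : ∀ x, 0 ≤ V x) (f : Lp ℝ 2 μ) :
    ‖sqrtMul V f‖ ^ 2 = ∫ x, V x * |f x| ^ 2 ∂μ := by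
  rw [← integral_norm_sq, integral_congr_ae (norm_sq_coeFn_sqrtMul hV f)]

theorem norm_sqrtMul_sq_le (hV : ∀ x, 0 ≤ V x) {M : ℝ} (hM : ∀ x, V x ≤ M) (f : Lp ℝ 2 μ) :
    ‖sqrtMul V f‖ ^ 2 ≤ M * ‖f‖ ^ 2 := by
  rw [norm_sqrtMul_sq hV, ← integral_norm_sq, ← integral_const_mul]
  exact integral_mono (integrable_mul_sq hV f) ((integrable_norm_sq f).const_mul M) fun x =>
    mul_le_mul_of_nonneg_right (hM x) (sq_nonneg _)

theorem two_mul_inner_le (hV : ∀ x, 0 < V x) {w : Lp ℝ 2 μ}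
    (hw : Integrable (fun x => |w x| ^ 2 / V x) μ) (f : Lp ℝ 2 μ) :
    2 * inner ℝ w f ≤ (∫ x, |w x| ^ 2 / V x ∂μ) + ‖sqrtMul V f‖ ^ 2 := by
  have hVf := integrable_mul_sq (fun x => (hV x).le) f
  rw [norm_sqrtMul_sq (fun x => (hV x).le), ← integral_add hw hVf, inner_eq_integral_mul,
    ← integral_const_mul]
  refine integral_mono (((Lp.memLp w).integrable_mul (Lp.memLp f)).const_mul 2) (hw.add hVf)
    fun x => ?_
  have hVx := hV x
  have hsq : |w x| ^ 2 / V x + V x * |f x| ^ 2 - 2 * (w x * f x) =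
      (w x - V x * f x) ^ 2 / V x := by
    rw [sq_abs, sq_abs]
    field_simp
    ring
  have hnonneg : 0 ≤ (w x - V x * f x) ^ 2 / V x := by positivity
  change 2 * (w x * f x) ≤ |w x| ^ 2 / V x + V x * |f x| ^ 2
  linarith

end SquareIntegrable

section WeakGradient

variable {n : ℕ} {φ ψ : Space n → ℝ}

theorem memLp_fderiv_apply (hφ : ContDiff ℝ 1 φ) (hc : HasCompactSupport φ) (v : Space n) :
    MemLp (fun x => fderiv ℝ φ x v) 2 (volume : Measure (Space n)) :=
  ((hφ.continuous_fderiv one_ne_zero).clm_apply continuous_const).memLp_of_hasCompactSupport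
    (hc.fderiv_apply ℝ v)

theorem memLp_smul_const (hφ : Continuous φ) (hc : HasCompactSupport φ) (v : Space n) :
    MemLp (fun x => φ x • v) 2 volume :=
  (hφ.smul continuous_const).memLp_of_hasCompactSupport hc.smul_right

theorem memLp_gradient (hφ : ContDiff ℝ 1 φ) (hc : HasCompactSupport φ) :
    MemLp (gradient φ) 2 volume :=
  ((InnerProductSpace.toDual ℝ (Space n)).symm.continuous.comp
    (hφ.continuous_fderiv one_ne_zero)).memLp_of_hasCompactSupport
    ((hc.fderiv ℝ).comp_left (map_zero (InnerProductSpace.toDual ℝ (Space n)).symm))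

theorem integral_mul_fderiv_apply (hφ : ContDiff ℝ 1 φ) (hc : HasCompactSupport φ)
    (hψ : ContDiff ℝ 1 ψ) (v : Space n) :
    ∫ x, φ x * fderiv ℝ ψ x v = -∫ x, fderiv ℝ φ x v * ψ x := by
  have hφ' := (hφ.continuous_fderiv one_ne_zero).clm_apply (continuous_const (y := v))
  have hψ' := (hψ.continuous_fderiv one_ne_zero).clm_apply (continuous_const (y := v))
  exact integral_mul_fderiv_eq_neg_fderiv_mul_of_integrable
    ((hφ'.mul hψ.continuous).integrable_of_hasCompactSupport (hc.fderiv_apply ℝ v).mul_right)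
    ((hφ.continuous.mul hψ').integrable_of_hasCompactSupport hc.mul_right)
    ((hφ.continuous.mul hψ.continuous).integrable_of_hasCompactSupport hc.mul_right)
    (fun x _ => hφ.differentiable one_ne_zero x) (fun x _ => hψ.differentiable one_ne_zero x)

theorem hasWeakGradient_toLp (hφ : ContDiff ℝ 1 φ) (hc : HasCompactSupport φ) :
    HasWeakGradient (hφ.continuous.memLp_of_hasCompactSupport hc).toLp
      (memLp_gradient hφ hc).toLp := by
  intro ψ hψ _ i
  have hφ₂ : MemLp φ 2 (volume : Measure (Space n)) :=
    hφ.continuous.memLp_of_hasCompactSupport hc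
  have hf : ∫ x, hφ₂.toLp φ x * fderiv ℝ ψ x (EuclideanSpace.single i 1) =
      ∫ x, φ x * fderiv ℝ ψ x (EuclideanSpace.single i 1) := by
    refine integral_congr_ae ?_
    filter_upwards [hφ₂.coeFn_toLp] with x hx
    rw [hx]
  have hG : ∫ x, (memLp_gradient hφ hc).toLp _ x i * ψ x =
      ∫ x, fderiv ℝ φ x (EuclideanSpace.single i 1) * ψ x := by
    refine integral_congr_ae ?_
    filter_upwards [(memLp_gradient hφ hc).coeFn_toLp] with x hx
    have hi : gradient φ x i = fderiv ℝ φ x (EuclideanSpace.single i 1) := by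
      rw [← inner_gradient_left, EuclideanSpace.inner_single_right, conj_trivial, one_mul]
    rw [hx, hi]
  rw [hf, hG, integral_mul_fderiv_apply hφ hc (hψ.of_le (by simp))]

/-- The defect `∫ f ∂ᵢφ + ∫ Gᵢ φ` of the integration by parts formula against a test function `φ`,
as a continuous linear functional of the pair `(f, G)`. -/
def integrationByPartsDefect (hφ : ContDiff ℝ 1 φ) (hc : HasCompactSupport φ) (i : Fin n) :
    L2 n × L2Vec n →L[ℝ] ℝ :=
  (innerSL ℝ (memLp_fderiv_apply hφ hc (EuclideanSpace.single i 1)).toLp).coprod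
    (innerSL ℝ (memLp_smul_const hφ.continuous hc (EuclideanSpace.single i 1)).toLp)

theorem integrationByPartsDefect_apply (hφ : ContDiff ℝ 1 φ) (hc : HasCompactSupport φ)
    (i : Fin n) (f : L2 n) (G : L2Vec n) :
    integrationByPartsDefect hφ hc i (f, G) =
      (∫ x, f x * fderiv ℝ φ x (EuclideanSpace.single i 1)) + ∫ x, G x i * φ x := by
  rw [integrationByPartsDefect, ContinuousLinearMap.coprod_apply, innerSL_apply_apply,
    innerSL_apply_apply, MeasureTheory.L2.inner_def, MeasureTheory.L2.inner_def]
  congr 1 <;> refine integral_congr_ae ?_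
  · filter_upwards [(memLp_fderiv_apply hφ hc (EuclideanSpace.single i 1)).coeFn_toLp] with x hx
    rw [hx]
    rfl
  · filter_upwards [(memLp_smul_const hφ.continuous hc (EuclideanSpace.single i 1)).coeFn_toLp]
      with x hx
    rw [hx, real_inner_smul_left, EuclideanSpace.inner_single_left, map_one, one_mul, mul_comm]

variable (n) in
/-- The set of pairs `(f, ∇f)` with `f ∈ H¹(ℝⁿ)`. -/
def weakGradientGraph : Submodule ℝ (L2 n × L2Vec n) :=
  ⨅ (φ : Space n → ℝ) (hφ : ContDiff ℝ ∞ φ) (hc : HasCompactSupport φ) (i : Fin n),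
    (integrationByPartsDefect (hφ.of_le (by simp)) hc i).ker

theorem mem_weakGradientGraph {f : L2 n} {G : L2Vec n} :
    (f, G) ∈ weakGradientGraph n ↔ HasWeakGradient f G := by
  simp only [weakGradientGraph, Submodule.mem_iInf, LinearMap.mem_ker,
    ContinuousLinearMap.coe_coe, integrationByPartsDefect_apply, add_eq_zero_iff_eq_neg,
    HasWeakGradient]

theorem isClosed_weakGradientGraph : IsClosed (weakGradientGraph n : Set (L2 n × L2Vec n)) := by
  simp only [weakGradientGraph, Submodule.coe_iInf]
  exact isClosed_iInter fun φ => isClosed_iInter fun hφ => isClosed_iInter fun hc =>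
    isClosed_iInter fun i => ContinuousLinearMap.isClosed_ker _

theorem HasWeakGradient.eq_zero {G : L2Vec n} (h : HasWeakGradient 0 G) : G = 0 := by
  have hG : ∀ i : Fin n, ∀ᵐ x, G x i = 0 := fun i => by
    have hi : MemLp (fun x => G x i) 2 volume :=
      (EuclideanSpace.proj (𝕜 := ℝ) i).comp_memLp' (Lp.memLp G)
    refine ae_eq_zero_of_integral_contDiff_smul_eq_zero (hi.locallyIntegrable one_le_two)
      fun φ hφ hc => ?_
    have hzero : ∫ x, (0 : L2 n) x * fderiv ℝ φ x (EuclideanSpace.single i 1) = 0 := by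
      refine integral_eq_zero_of_ae ?_
      filter_upwards [Lp.coeFn_zero ℝ 2 (volume : Measure (Space n))] with x hx
      simp only [hx, Pi.zero_apply, zero_mul]
    simpa only [smul_eq_mul, mul_comm, hzero, zero_eq_neg] using h φ hφ hc i
  rw [Lp.eq_zero_iff_ae_eq_zero]
  filter_upwards [ae_all_iff.2 hG] with x hx
  exact PiLp.ext hx

variable (n) in
/-- The weak gradient as an unbounded operator on `L²(ℝⁿ)` with domain `H¹(ℝⁿ)`. -/
def weakGradient : L2 n →ₗ.[ℝ] L2Vec n :=
  (weakGradientGraph n).toLinearPMap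

theorem graph_weakGradient : (weakGradient n).graph = weakGradientGraph n := by
  refine Submodule.toLinearPMap_graph_eq _ ?_
  rintro ⟨f, G⟩ hfG (rfl : f = 0)
  exact (mem_weakGradientGraph.1 hfG).eq_zero

theorem isClosed_weakGradient : (weakGradient n).IsClosed := by
  rw [LinearPMap.IsClosed, graph_weakGradient]
  exact isClosed_weakGradientGraph

theorem dense_domain_weakGradient : Dense ((weakGradient n).domain : Set (L2 n)) := by
  refine (Lp.dense_hasCompactSupport_contDiff (by simp)).mono ?_
  rintro f ⟨φ, hfφ, hc, hφ⟩
  have hφ' : ContDiff ℝ 1 φ := hφ.of_le (by simp)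
  have hf : f = (hφ.continuous.memLp_of_hasCompactSupport hc).toLp :=
    Lp.ext (hfφ.trans (MemLp.coeFn_toLp _).symm)
  rw [hf]
  refine LinearPMap.mem_domain_of_mem_graph (y := (memLp_gradient hφ' hc).toLp) ?_
  rw [graph_weakGradient, mem_weakGradientGraph]
  exact hasWeakGradient_toLp hφ' hc

end WeakGradient

section DampedWaveEquation

variable {n : ℕ} {V : Space n →ᵇ ℝ} {u₀ u₁ : L2 n} {Du₀ : L2Vec n} {u v ut vt : ℝ → L2 n}
  {Du Dv : ℝ → L2Vec n} {F : ℝ → WithLp 2 (L2Vec n × L2 n)}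

/-- The operator `f ↦ (∇f, √V f)` with domain `H¹(ℝⁿ)`, a square root of `-Δ + V`. -/
def energyOperator (V : Space n →ᵇ ℝ) : L2 n →ₗ.[ℝ] WithLp 2 (L2Vec n × L2 n) :=
  pairOperator (weakGradient n) (sqrtMul V)

theorem mem_graph_energyOperator {f : L2 n} {F : WithLp 2 (L2Vec n × L2 n)} :
    (f, F) ∈ (energyOperator V).graph ↔ HasWeakGradient f F.fst ∧ F.snd = sqrtMul V f := by
  rw [energyOperator, mem_graph_pairOperator, graph_weakGradient, mem_weakGradientGraph]

theorem isClosed_energyOperator : (energyOperator V).IsClosed :=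
  isClosed_pairOperator isClosed_weakGradient

theorem dense_domain_energyOperator : Dense ((energyOperator V).domain : Set (L2 n)) :=
  dense_domain_weakGradient

theorem HasWeakGradient.exists_energyOperator_eq {f : L2 n} {G : L2Vec n}
    (h : HasWeakGradient f G) : ∃ φ : (energyOperator V).domain,
      f = φ ∧ WithLp.toLp 2 (G, sqrtMul V f) = energyOperator V φ := by
  obtain ⟨φ, hφ, hGφ⟩ := (energyOperator V).mem_graph_iff.1
    (mem_graph_energyOperator.2 ⟨h, rfl⟩ : (f, WithLp.toLp 2 (G, sqrtMul V f)) ∈ _)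
  exact ⟨φ, hφ.symm, hGφ.symm⟩

theorem inner_toLp_sqrtMul (hV : ∀ x, 0 ≤ V x) (f g : L2 n) (F G : L2Vec n) :
    inner ℝ (WithLp.toLp 2 (F, sqrtMul V f)) (WithLp.toLp 2 (G, sqrtMul V g)) =
      (∫ x, inner ℝ (F x) (G x)) + ∫ x, V x * f x * g x := by
  rw [WithLp.prod_inner_apply, ← inner_sqrtMul hV]
  rfl

theorem energy_eq (hV : ∀ x, 0 ≤ V x) (f g : L2 n) (G : L2Vec n) :
    energy V f g G = 1 / 2 * (‖g‖ ^ 2 + ‖WithLp.toLp 2 (G, sqrtMul V f)‖ ^ 2) := by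
  have hg : Integrable (fun x => |g x| ^ 2) := integrable_norm_sq g
  have hg' : ∫ x, |g x| ^ 2 = ‖g‖ ^ 2 := integral_norm_sq g
  rw [energy, integral_add (hg.fun_add (integrable_norm_sq G)) (integrable_mul_sq hV f),
    integral_add hg (integrable_norm_sq G), hg', integral_norm_sq, ← norm_sqrtMul_sq hV,
    WithLp.prod_norm_sq_eq_of_L2, WithLp.toLp_fst, WithLp.toLp_snd, add_assoc]

theorem two_mul_inner_add_le (hV : ∀ x, 0 < V x)
    (hK : Integrable fun x => |u₁ x + u₀ x| ^ 2 / V x) (φ : (energyOperator V).domain) :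
    2 * inner ℝ (u₁ + u₀) (φ : L2 n) ≤
      (∫ x, |u₁ x + u₀ x| ^ 2 / V x) + ‖energyOperator V φ‖ ^ 2 := by
  have hsum : (fun x => |(u₁ + u₀) x| ^ 2 / V x) =ᵐ[volume]
      fun x => |u₁ x + u₀ x| ^ 2 / V x := by
    filter_upwards [Lp.coeFn_add u₁ u₀] with x hx
    rw [hx, Pi.add_apply]
  have hφ := (mem_graph_energyOperator.1 ((energyOperator V).mem_graph φ)).2
  have hdual := two_mul_inner_le hV ((integrable_congr hsum).2 hK) (φ : L2 n)
  rw [integral_congr_ae hsum, ← hφ] at hdual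
  rw [WithLp.prod_norm_sq_eq_of_L2]
  linarith [sq_nonneg ‖(energyOperator V φ).fst‖]

theorem IsWeakSolution.isDampedWaveSolution (hV : ∀ x, 0 ≤ V x)
    (h : IsWeakSolution V u₀ u₁ u ut Du) :
    IsDampedWaveSolution (energyOperator V) u ut
      (fun t => WithLp.toLp 2 (Du t, sqrtMul V (u t))) where
  mem_graph t ht := mem_graph_energyOperator.2 ⟨h.hasWeakGradient t ht, rfl⟩
  continuousOn_operator := (WithLp.prod_continuous_toLp 2 _ _).comp_continuousOn
    (h.continuousOn_gradient.prodMk ((sqrtMul V).continuous.comp_continuousOn h.continuousOn))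
  hasDerivWithinAt := h.hasDerivWithinAt
  continuousOn_deriv := h.continuousOn_deriv
  equation φ t ht := by
    obtain ⟨hφ, hφV⟩ := mem_graph_energyOperator.1 ((energyOperator V).mem_graph φ)
    have hDφ : energyOperator V φ =
        WithLp.toLp 2 ((energyOperator V φ).fst, sqrtMul V (φ : L2 n)) :=
      WithLp.ofLp_injective 2 (Prod.ext rfl hφV)
    rw [hDφ, inner_toLp_sqrtMul hV]
    simpa only [inner_eq_integral_mul] using h.equation φ _ hφ t ht

theorem IsDampedWaveSolution.isWeakSolution (hV : ∀ x, 0 ≤ V x)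
    (h : IsDampedWaveSolution (energyOperator V) u ut F) :
    IsWeakSolution V (u 0) (ut 0) u ut (fun t => (F t).fst) where
  hasWeakGradient t ht := (mem_graph_energyOperator.1 (h.mem_graph t ht)).1
  continuousOn := h.continuousOn
  continuousOn_gradient :=
    (WithLp.fstL 2 ℝ _ _).continuous.comp_continuousOn h.continuousOn_operator
  hasDerivWithinAt := h.hasDerivWithinAt
  continuousOn_deriv := h.continuousOn_deriv
  initial := rfl
  initial_deriv := rfl
  equation f G hfG t ht := by
    obtain ⟨φ, rfl, hφ⟩ := hfG.exists_energyOperator_eq (V := V)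
    have hF : F t = WithLp.toLp 2 ((F t).fst, sqrtMul V (u t)) := WithLp.ofLp_injective 2
      (Prod.ext rfl (mem_graph_energyOperator.1 (h.mem_graph t ht.le)).2)
    have heq := h.equation φ t ht
    rw [← hφ, hF, inner_toLp_sqrtMul hV] at heq
    simpa only [inner_eq_integral_mul] using heq

theorem exists_isWeakSolution (hV : ∀ x, 0 ≤ V x) (hDu₀ : HasWeakGradient u₀ Du₀) (u₁ : L2 n) :
    ∃ u ut Du, IsWeakSolution V u₀ u₁ u ut Du := by
  obtain ⟨φ, rfl, -⟩ := hDu₀.exists_energyOperator_eq (V := V)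
  obtain ⟨u, ut, F, h, hu, rfl⟩ :=
    exists_isDampedWaveSolution isClosed_energyOperator dense_domain_energyOperator φ u₁
  rw [← hu]
  exact ⟨u, ut, _, h.isWeakSolution hV⟩

namespace IsWeakSolution

theorem unique (hV : ∀ x, 0 ≤ V x) (hu : IsWeakSolution V u₀ u₁ u ut Du)
    (hv : IsWeakSolution V u₀ u₁ v vt Dv) {t : ℝ} (ht : 0 ≤ t) :
    v t = u t ∧ vt t = ut t ∧ Dv t = Du t := by
  obtain ⟨hEq, hEqt, hEqD⟩ := (hv.isDampedWaveSolution hV).eqOn isClosed_energyOperator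
    dense_domain_energyOperator (hu.isDampedWaveSolution hV) (hv.initial.trans hu.initial.symm)
    (hv.initial_deriv.trans hu.initial_deriv.symm)
  exact ⟨hEq ht, hEqt ht, congrArg WithLp.fst (hEqD ht)⟩

theorem gradient_initial (h : IsWeakSolution V u₀ u₁ u ut Du) (hDu₀ : HasWeakGradient u₀ Du₀) :
    Du 0 = Du₀ := by
  have hDu := h.hasWeakGradient 0 le_rfl
  rw [h.initial] at hDu
  rw [← mem_weakGradientGraph, ← graph_weakGradient] at hDu hDu₀
  exact LinearPMap.mem_graph_snd_inj _ hDu hDu₀ rfl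

theorem decay (hV : ∀ x, 0 < V x) {M : ℝ} (hM : ∀ x, V x ≤ M)
    (h : IsWeakSolution V u₀ u₁ u ut Du) (hDu₀ : HasWeakGradient u₀ Du₀)
    (hK : Integrable fun x => |u₁ x + u₀ x| ^ 2 / V x) {t : ℝ} (ht : 0 ≤ t) :
    (1 + t) ^ 2 * energy V (u t) (ut t) (Du t) + 1 / 4 * (1 + t) * ‖u t‖ ^ 2 ≤
      (4 + 3 * |M|) * (‖u₀‖ ^ 2 + ‖u₁‖ ^ 2 + ‖Du₀‖ ^ 2 + ∫ x, |u₁ x + u₀ x| ^ 2 / V x) := by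
  have hdecay := (h.isDampedWaveSolution fun x => (hV x).le).decay isClosed_energyOperator
    dense_domain_energyOperator (fun φ => by
      rw [h.initial, h.initial_deriv]
      exact two_mul_inner_add_le hV hK φ) ht
  rw [waveEnergy, ← energy_eq fun x => (hV x).le, h.initial, h.initial_deriv,
    h.gradient_initial hDu₀, WithLp.prod_norm_sq_eq_of_L2, WithLp.toLp_fst,
    WithLp.toLp_snd] at hdecay
  have hpot : ‖sqrtMul V u₀‖ ^ 2 ≤ |M| * ‖u₀‖ ^ 2 :=
    norm_sqrtMul_sq_le (fun x => (hV x).le) (fun x => (hM x).trans (le_abs_self M)) u₀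
  have hK₀ : 0 ≤ ∫ x, |u₁ x + u₀ x| ^ 2 / V x :=
    integral_nonneg fun x => div_nonneg (sq_nonneg _) (hV x).le
  have hrest : 0 ≤ |M| * (‖u₁‖ ^ 2 + ‖Du₀‖ ^ 2 + ∫ x, |u₁ x + u₀ x| ^ 2 / V x) := by positivity
  linarith [sq_nonneg ‖u₀‖, sq_nonneg ‖Du₀‖]

end IsWeakSolution

end DampedWaveEquation

end DampedWave

end

theorem theorem1p3 (M : ℝ) :
    ∃ C : ℝ, 0 < C ∧ ∀ n : ℕ, 1 ≤ n →
      ∀ V : BoundedContinuousFunction (DampedWave.Space n) ℝ, (∀ x, 0 < V x) → (∀ x, V x ≤ M) →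
      ∀ (u₀ u₁ : DampedWave.L2 n) (Du₀ : DampedWave.L2Vec n),
        DampedWave.HasWeakGradient u₀ Du₀ →
        MeasureTheory.Integrable (fun x => |u₁ x + u₀ x| ^ 2 / V x) MeasureTheory.volume →
        ∃ (u ut : ℝ → DampedWave.L2 n) (Du : ℝ → DampedWave.L2Vec n),
          DampedWave.IsWeakSolution V u₀ u₁ u ut Du ∧
          (∀ (v vt : ℝ → DampedWave.L2 n) (Dv : ℝ → DampedWave.L2Vec n),
            DampedWave.IsWeakSolution V u₀ u₁ v vt Dv →
              ∀ t, 0 ≤ t → v t = u t ∧ vt t = ut t ∧ Dv t = Du t) ∧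
          ∀ t : ℝ, 0 ≤ t →
            (1 + t) ^ 2 * DampedWave.energy V (u t) (ut t) (Du t) ≤
              C * (‖u₀‖ ^ 2 + ‖u₁‖ ^ 2 + ‖Du₀‖ ^ 2 + ∫ x, |u₁ x + u₀ x| ^ 2 / V x) ∧
            (1 + t) * ‖u t‖ ^ 2 ≤
              C * (‖u₀‖ ^ 2 + ‖u₁‖ ^ 2 + ‖Du₀‖ ^ 2 + ∫ x, |u₁ x + u₀ x| ^ 2 / V x) := by
  refine ⟨16 + 12 * |M|, by positivity, fun n _ V hV hM u₀ u₁ Du₀ hDu₀ hK => ?_⟩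
  have hV₀ : ∀ x, 0 ≤ V x := fun x => (hV x).le
  obtain ⟨u, ut, Du, h⟩ := DampedWave.exists_isWeakSolution hV₀ hDu₀ u₁
  refine ⟨u, ut, Du, h, fun v vt Dv hv t ht => h.unique hV₀ hv ht, fun t ht => ?_⟩
  have hdecay := h.decay hV hM hDu₀ hK ht
  have hE : 0 ≤ (1 + t) ^ 2 * DampedWave.energy V (u t) (ut t) (Du t) := by
    rw [DampedWave.energy_eq hV₀]
    positivity
  have hu : 0 ≤ (1 + t) * ‖u t‖ ^ 2 := by positivity
  constructor <;> linarith
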